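/- Let $\mathcal{QC}=(s_n)_{n\in\mathbb Z}$ be a strictly increasing bi-infinite sequence of real numbers (atoms) that is a quasicrystal. Two segments $(s_n,\dots,s_{n+p})$ and $(s_m,\dots,s_{m+p})$ are called equivalent if they differ by a translation, and quasicrystal means: (finite local complexity) for every $M>0$ there are finitely many equivalence classes of segments of diameter $<M$; (repetitivity) for every segment there is $R'>0$ such that every ball of radius $R'$ contains an equivalent segment; (uniform pattern distribution) for every segment, the number of equivalent segments in $[x,x+M]$ divided by $M$ converges as $M\to+\infty$, uniformly in $x\in\mathbb R$, to a limit independent of $x$. Assume that $\mathcal{QC}$ is not a crystal, i.e. there are no integer $q>0$ and real $L>0$ with $s_{n+q}=s_n+L$ for all $n$. Let $U,V:\mathbb R\to\mathbb R$ be $C^2$ with $U''>0$ everywhere and $U(x)/|x|\to+\infty$ as $x\to\pm\infty$, and let $V$ have range $R>0$: $V(x)=V(y)$ whenever $(\mathcal{QC}\cap B_R(x))-x=(\mathcal{QC}\cap B_R(y))-y$. A minimal configuration is a non-decreasing sequence $(\theta_n)_{n\in\mathbb Z}$ of reals such that for all $i\in\mathbb Z$, $p\ge 0$ and all reals $\theta'_i,\dots,\theta'_{i+p}$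 with $\theta'_i=\theta_i$, $\theta'_{i+p}=\theta_{i+p}$, one has $\sum_{j=0}^{p-1}\big(U(\theta_{i+j}-\theta_{i+j+1})+V(\theta_{i+j})\big)\le\sum_{j=0}^{p-1}\big(U(\theta'_{i+j}-\theta'_{i+j+1})+V(\theta'_{i+j})\big)$. It has rotation number $\rho$ if $\theta_n/n\to\rho$ as $n\to+\infty$ and as $n\to-\infty$. For point sets $T,T'\subset\mathbb R$ let $\delta(T,T')$ be the infimum of the $\epsilon\in\,]0,1[$ such that, for some $|u|<\epsilon$, the sets $T$ and $T'+u$ coincide in $B_{1/\epsilon}(0)$ ($\delta=1$ if there is none), and use the distance $\max(\delta(T,T'),\delta(T',T))$. The hull $\Omega$ is the completion of $\{\mathcal{QC}-x : x\in\mathbb R\}$, realised as the set of all point sets that are limits of translates $\mathcal{QC}-x$. Let $\mu$ be the Borel probability measure on $\Omega$ invariant under the translations $T\mapsto T-u$. Let $\Omega_0=\{T\in\Omega : 0\in T\}$, and for $\mathcal C\subset\Omega$ let $\mathcal L_{\mathcal C}(T)=\inf\{t>0 : T-t\in\mathcal C\}$. A clopen piece is a clopen subset $\mathcal C$ of $\Omega_0$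 on which $\mathcal L_{\Omega_0}$ is a constant $L$; its transverse measure is $\nu(\mathcal C)=\frac1L\,\mu(\{T-u : T\in\mathcal C,\ 0\le u\le L\})$. A vertical is a set $\mathcal C-u$ with $\mathcal C$ a clopen piece with constant $L$ and $u\in[0,L[$. For each $S>0$ fix $\epsilon(S)>0$ such that, whenever $\mathcal{QC}-x$ and $\mathcal{QC}-y$ lie in a common vertical of diameter $<\epsilon(S)$, then $(\mathcal{QC}\cap B_S(x))-x=(\mathcal{QC}\cap B_S(y))-y$. A Kakutani–Rohlin towers system of size $S$ consists of a non-empty clopen piece $\mathcal C$ of diameter $<\epsilon(S)$ and a finite partition of $\mathcal C$ into non-empty clopen sets $\mathcal E_1,\dots,\mathcal E_r$ such that $\mathcal L_{\mathcal C}$ is a constant $h_j$ on $\mathcal E_j$ and $\mathcal E_j-u$ is a vertical of diameter $<\epsilon(S)$ for each $u\in[0,h_j[$; its towers are the sets $\{T-u : T\in\mathcal E_j,\ 0\le u<h_j\}$. Let $S_0<S_1<\cdots$ tend to $+\infty$ with $S_0>R$, let $x_0\in\Omega_0$, and for each $l\ge 0$ let $(\mathcal C_l,\{\mathcal E_{l,j}\}_{1\le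 j\le r_l})$ be a Kakutani–Rohlin towers system of size $S_l$, indexed so that $x_0\in\mathcal E_{l,1}$, with $\mathcal C_{l+1}\subset\mathcal E_{l,1}$ and such that each tower of the system $l+1$ intersects all the towers of the system $l$. Put $\nu_{l,j}=\nu(\mathcal E_{l,j})$ and $$\mathcal F=\Big\{\frac1{\sum_{j=1}^{r_l}N_{l,j}\nu_{l,j}} : l\ge 0,\ N_{l,1},\dots,N_{l,r_l}\text{ positive integers}\Big\}.$$ Then for every $\rho_0\in\mathcal F$ there is a minimal configuration with rotation number $\rho_0$. Moreover $\mathcal F\subset\,]0,+\infty[$ and $\mathcal F$ is dense in $]0,+\infty[$. -/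

import Mathlib

open Set Filter Topology MeasureTheory

noncomputable section

/-! ### Quasicrystals and potentials -/

/-- The segments `(s n, …, s (n+p))` and `(s m, …, s (m+p))` of a chain are equivalent:
they differ by a translation. -/
def SegEquiv (s : ℤ → ℝ) (p : ℕ) (n m : ℤ) : Prop :=
  ∃ τ : ℝ, ∀ i : ℕ, i ≤ p → s (m + i) = s (n + i) + τ

/-- Finite local complexity: for every `M > 0` there are finitely many equivalence classes of
segments of diameter smaller than `M` (`F` is a finite family of representatives). -/
def FiniteLocalComplexity (s : ℤ → ℝ) : Prop :=
  ∀ M : ℝ, 0 < M → ∃ F : Finset (ℕ × ℤ),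
    ∀ (p : ℕ) (n : ℤ), s (n + p) - s n < M → ∃ m : ℤ, (p, m) ∈ F ∧ SegEquiv s p m n

/-- Repetitivity: for every segment there is `R > 0` such that every ball of radius `R` contains
a segment equivalent to it. -/
def Repetitive (s : ℤ → ℝ) : Prop :=
  ∀ (p : ℕ) (n : ℤ), ∃ R : ℝ, 0 < R ∧ ∀ x : ℝ, ∃ m : ℤ,
    SegEquiv s p n m ∧ ∀ i : ℕ, i ≤ p → s (m + i) ∈ Metric.ball x R

/-- The number of segments in `[x, x + M]` equivalent to `(s n, …, s (n+p))`. -/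
def segCount (s : ℤ → ℝ) (p : ℕ) (n : ℤ) (x M : ℝ) : ℕ :=
  Set.ncard {m : ℤ | SegEquiv s p n m ∧ ∀ i : ℕ, i ≤ p → s (m + i) ∈ Set.Icc x (x + M)}

/-- Uniform pattern distribution: every segment has a frequency, and the convergence to it is
uniform in the position `x`. -/
def UniformPatternDistribution (s : ℤ → ℝ) : Prop :=
  ∀ (p : ℕ) (n : ℤ), ∃ ν : ℝ,
    TendstoUniformly (fun (M : ℝ) (x : ℝ) => (segCount s p n x M : ℝ) / M) (fun _ => ν) atTop

/-- A quasicrystal: an increasing bi-infinite chain of atoms with finite local complexity,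
repetitivity and uniform pattern distribution. -/
structure IsQuasicrystal (s : ℤ → ℝ) : Prop where
  strictMono : StrictMono s
  finiteLocalComplexity : FiniteLocalComplexity s
  repetitive : Repetitive s
  uniformPatternDistribution : UniformPatternDistribution s

/-- A crystal: a chain which is periodic up to translation. -/
def IsCrystal (s : ℤ → ℝ) : Prop :=
  ∃ (q : ℕ) (L : ℝ), 0 < q ∧ 0 < L ∧ ∀ n : ℤ, s (n + q) = s n + L

/-- The translated point set `T - u`. -/
def shiftSet (T : Set ℝ) (u : ℝ) : Set ℝ := {z | z + u ∈ T}

/-- `T ∩ B_r(x) - x`, the part of `T` in the ball `B_r(x)`, seen from `x`. -/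
def localPatch (T : Set ℝ) (r x : ℝ) : Set ℝ := shiftSet (T ∩ Metric.ball x r) x

/-- `V` is a potential with range `R` associated with the point set `Q`. -/
def HasRange (Q : Set ℝ) (V : ℝ → ℝ) (R : ℝ) : Prop :=
  ∀ x y : ℝ, localPatch Q R x = localPatch Q R y → V x = V y

/-! ### Minimal configurations -/

/-- The energy `∑_{j<p} U(θ_{i+j} - θ_{i+j+1}) + V(θ_{i+j})` of a segment of `θ`. -/
def segEnergy (U V : ℝ → ℝ) (θ : ℤ → ℝ) (i : ℤ) (p : ℕ) : ℝ :=
  ∑ j ∈ Finset.range p, (U (θ (i + j) - θ (i + j + 1)) + V (θ (i + j)))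

/-- A minimal configuration: a non-decreasing sequence each of whose segments has least energy
among all segments with the same number of atoms and the same extremities. -/
def IsMinimalConfiguration (U V : ℝ → ℝ) (θ : ℤ → ℝ) : Prop :=
  Monotone θ ∧ ∀ (i : ℤ) (p : ℕ) (θ' : ℤ → ℝ), θ' i = θ i → θ' (i + p) = θ (i + p) →
    segEnergy U V θ i p ≤ segEnergy U V θ' i p

/-- `θ` has rotation number `ρ`: `θ_n / n → ρ` as `n → ±∞`. -/
def HasRotationNumber (θ : ℤ → ℝ) (ρ : ℝ) : Prop :=
  Tendsto (fun n : ℤ => θ n / (n : ℝ)) atTop (𝓝 ρ) ∧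
  Tendsto (fun n : ℤ => θ n / (n : ℝ)) atBot (𝓝 ρ)

/-! ### The hull -/

/-- The set of `ε ∈ ]0,1[` for which there is `u` with `|u| < ε` such that `T` and `T' + u`
coincide in `B_{1/ε}(0)`. -/
def closeSet (T T' : Set ℝ) : Set ℝ :=
  {ε | 0 < ε ∧ ε < 1 ∧ ∃ u : ℝ, |u| < ε ∧
    T ∩ Metric.ball 0 (1 / ε) = shiftSet T' (-u) ∩ Metric.ball 0 (1 / ε)}

open Classical in
/-- The infimum of `closeSet T T'`, and `1` if that set is empty. -/
def patchGap (T T' : Set ℝ) : ℝ :=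
  if (closeSet T T').Nonempty then sInf (closeSet T T') else 1

/-- The distance between point sets. `patchGap` satisfies the triangle inequality, but moving the
ball by `u` makes it slightly asymmetric, hence the maximum over the two orders. -/
def patchDist (T T' : Set ℝ) : ℝ := max (patchGap T T') (patchGap T' T)

theorem closeSet_bddBelow (T T' : Set ℝ) : BddBelow (closeSet T T') :=
  ⟨0, fun _ h => h.1.le⟩

theorem patchGap_nonneg (T T' : Set ℝ) : 0 ≤ patchGap T T' := by
  unfold patchGap
  split_ifs with h
  · exact le_csInf h fun _ h => h.1.le
  · exact zero_le_one

theorem patchGap_le_one (T T' : Set ℝ) : patchGap T T' ≤ 1 := by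
  unfold patchGap
  split_ifs with h
  · obtain ⟨ε, hε⟩ := h
    exact (csInf_le (closeSet_bddBelow _ _) hε).trans hε.2.1.le
  · exact le_rfl

theorem patchGap_le {T T' : Set ℝ} {ε : ℝ} (h : ε ∈ closeSet T T') : patchGap T T' ≤ ε := by
  unfold patchGap
  rw [if_pos ⟨ε, h⟩]
  exact csInf_le (closeSet_bddBelow _ _) h

theorem exists_of_patchGap_lt {T T' : Set ℝ} {a : ℝ} (h : patchGap T T' < a) (ha : a ≤ 1) :
    ∃ ε ∈ closeSet T T', ε < a := by
  unfold patchGap at h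
  split_ifs at h with hne
  · exact exists_lt_of_csInf_lt hne h
  · linarith

theorem mem_closeSet_of_inter_eq {T T' : Set ℝ} {ε : ℝ} (h0 : 0 < ε) (h1 : ε < 1)
    (h : T ∩ Metric.ball 0 (1 / ε) = T' ∩ Metric.ball 0 (1 / ε)) : ε ∈ closeSet T T' := by
  refine ⟨h0, h1, 0, by simpa using h0, ?_⟩
  simpa [shiftSet] using h

theorem patchGap_self (T : Set ℝ) : patchGap T T = 0 := by
  refine le_antisymm (le_of_forall_pos_le_add fun η hη => ?_) (patchGap_nonneg _ _)
  have hm : min η (1 / 2) ∈ closeSet T T :=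
    mem_closeSet_of_inter_eq (lt_min hη (by norm_num))
      (lt_of_le_of_lt (min_le_right _ _) (by norm_num)) rfl
  simpa using (patchGap_le hm).trans (min_le_left _ _)

theorem patchGap_triangle (T₁ T₂ T₃ : Set ℝ) :
    patchGap T₁ T₃ ≤ patchGap T₁ T₂ + patchGap T₂ T₃ := by
  by_contra! hlt
  have h13 := patchGap_le_one T₁ T₃
  have h12 := patchGap_nonneg T₁ T₂
  have h23 := patchGap_nonneg T₂ T₃
  obtain ⟨a, ha, ha'⟩ : ∃ a ∈ closeSet T₁ T₂,
      a < patchGap T₁ T₂ + (patchGap T₁ T₃ - (patchGap T₁ T₂ + patchGap T₂ T₃)) / 2 :=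
    exists_of_patchGap_lt (by linarith) (by linarith)
  obtain ⟨b, hb, hb'⟩ : ∃ b ∈ closeSet T₂ T₃,
      b < patchGap T₂ T₃ + (patchGap T₁ T₃ - (patchGap T₁ T₂ + patchGap T₂ T₃)) / 2 :=
    exists_of_patchGap_lt (by linarith) (by linarith)
  have hab : a + b < patchGap T₁ T₃ := by linarith
  obtain ⟨ha0, ha1, u, hu, hTu⟩ := ha
  obtain ⟨hb0, hb1, v, hv, hTv⟩ := hb
  refine absurd (patchGap_le (T := T₁) (T' := T₃) (ε := a + b)
    ⟨by linarith, by linarith, u + v, ?_, ?_⟩) (not_le.2 hab)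
  · exact (abs_add_le u v).trans_lt (by linarith)
  · ext z
    simp only [mem_inter_iff, Metric.mem_ball, dist_zero_right, Real.norm_eq_abs, shiftSet,
      mem_ofPred_eq, and_congr_left_iff]
    intro hz
    have hza : |z| < 1 / a :=
      hz.trans_le (one_div_le_one_div_of_le ha0 (by linarith))
    have hzb : |z + -u| < 1 / b := by
      have h1 : |z + -u| ≤ |z| + |u| := by simpa using abs_add_le z (-u)
      have h2 : 1 / (a + b) + a ≤ 1 / b := by
        rw [div_add' _ _ _ (by positivity), div_le_div_iff₀ (by positivity) hb0]
        nlinarith [mul_pos ha0 hb0, mul_nonneg ha0.le (by nlinarith : (0 : ℝ) ≤ 1 - b * (a + b))]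
      linarith
    have e1 : z ∈ T₁ ↔ z + -u ∈ T₂ := by
      have := Set.ext_iff.1 hTu z
      simp only [mem_inter_iff, Metric.mem_ball, dist_zero_right, Real.norm_eq_abs, shiftSet,
        mem_ofPred_eq, hza, and_true] at this
      exact this
    have e2 : z + -u ∈ T₂ ↔ z + -u + -v ∈ T₃ := by
      have := Set.ext_iff.1 hTv (z + -u)
      simp only [mem_inter_iff, Metric.mem_ball, dist_zero_right, Real.norm_eq_abs, shiftSet,
        mem_ofPred_eq, hzb, and_true] at this
      exact this
    rw [e1, e2, neg_add, add_assoc]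

/-- The continuous hull of `Q`, the completion of the set of translated copies `Q - x`, realised
as the set of all point sets that are limits of translated copies of `Q`. -/
def Hull (Q : Set ℝ) : Type :=
  {T : Set ℝ // ∀ ε : ℝ, 0 < ε → ∃ x : ℝ, patchDist T (shiftSet Q x) < ε}

namespace Hull

variable {Q : Set ℝ}

instance : PseudoMetricSpace (Hull Q) where
  dist T T' := patchDist T.1 T'.1
  dist_self T := by simp [patchDist, patchGap_self]
  dist_comm T T' := max_comm _ _
  dist_triangle T₁ T₂ T₃ := by
    refine max_le ?_ ?_
    · exact (patchGap_triangle T₁.1 T₂.1 T₃.1).trans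
        (add_le_add (le_max_left _ _) (le_max_left _ _))
    · refine (patchGap_triangle T₃.1 T₂.1 T₁.1).trans ?_
      rw [add_comm]
      exact add_le_add (le_max_right _ _) (le_max_right _ _)

instance : MeasurableSpace (Hull Q) := borel (Hull Q)

instance : BorelSpace (Hull Q) := ⟨rfl⟩

end Hull

theorem hull_condition_iff (Q T : Set ℝ) :
    (∀ ε : ℝ, 0 < ε → ∃ x : ℝ, patchDist T (shiftSet Q x) < ε) ↔
      ∀ M : ℝ, 0 < M → ∃ x : ℝ, T ∩ Metric.ball 0 M = shiftSet Q x ∩ Metric.ball 0 M := by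
  constructor
  · intro h M hM
    obtain ⟨x, hx⟩ := h (min (1 / M) 1) (lt_min (by positivity) one_pos)
    obtain ⟨ε, ⟨h0, -, u, -, hT⟩, hε⟩ :=
      exists_of_patchGap_lt ((le_max_left _ _).trans_lt hx) (min_le_right _ _)
    refine ⟨x - u, ?_⟩
    have hM' : M ≤ 1 / ε := by
      rw [le_div_iff₀ h0, mul_comm, ← le_div_iff₀ hM]
      exact (hε.trans_le (min_le_left _ _)).le
    ext z
    have hz := Set.ext_iff.1 hT z
    simp only [mem_inter_iff, Metric.mem_ball, dist_zero_right, Real.norm_eq_abs, shiftSet,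
      mem_ofPred_eq, and_congr_left_iff] at hz ⊢
    intro hzM
    rw [hz (hzM.trans_le hM'), show z + -u + x = z + (x - u) by ring]
  · intro h ε hε
    have hη : 0 < min (ε / 2) (1 / 2) := lt_min (by linarith) (by norm_num)
    have hη1 : min (ε / 2) (1 / 2) < 1 := (min_le_right _ _).trans_lt (by norm_num)
    obtain ⟨x, hx⟩ := h (1 / min (ε / 2) (1 / 2)) (by positivity)
    refine ⟨x, max_lt ?_ ?_⟩
    · exact (patchGap_le (mem_closeSet_of_inter_eq hη hη1 hx)).trans_lt
        ((min_le_left _ _).trans_lt (by linarith))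
    · exact (patchGap_le (mem_closeSet_of_inter_eq hη hη1 hx.symm)).trans_lt
        ((min_le_left _ _).trans_lt (by linarith))

namespace Hull

variable {Q : Set ℝ}

/-- The immersion `x ↦ Q - x` of the real line in the hull. -/
def ofReal (Q : Set ℝ) (x : ℝ) : Hull Q :=
  ⟨shiftSet Q x, fun ε hε => ⟨x, by simpa [patchDist, patchGap_self] using hε⟩⟩

/-- The translation action `T ↦ T - u` on the hull. -/
def shift (u : ℝ) (T : Hull Q) : Hull Q :=
  ⟨shiftSet T.1 u, by
    rw [hull_condition_iff]
    intro M hM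
    obtain ⟨x, hx⟩ := (hull_condition_iff Q T.1).1 T.2 (M + |u|) (by positivity)
    refine ⟨u + x, ?_⟩
    ext z
    have hz := Set.ext_iff.1 hx (z + u)
    simp only [mem_inter_iff, Metric.mem_ball, dist_zero_right, Real.norm_eq_abs, shiftSet,
      mem_ofPred_eq, and_congr_left_iff] at hz ⊢
    intro hzM
    rw [hz ((abs_add_le z u).trans_lt (by linarith)), add_assoc]⟩

/-- The canonical transversal: the elements of the hull with an atom at `0`. -/
def transversal (Q : Set ℝ) : Set (Hull Q) := {T | (0 : ℝ) ∈ T.1}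

/-- The first return time of `T` to `C` under the translation flow. -/
def returnTime (C : Set (Hull Q)) (T : Hull Q) : ℝ := sInf {t : ℝ | 0 < t ∧ shift t T ∈ C}

/-- `C` is a clopen subset of the canonical transversal contained in the set where the first
return time to the transversal equals `L`. -/
structure IsClopenPiece (C : Set (Hull Q)) (L : ℝ) : Prop where
  subset : C ⊆ transversal Q
  isClopen : IsClopen ((↑) ⁻¹' C : Set (transversal Q))
  returnTime_eq : ∀ T ∈ C, returnTime (transversal Q) T = L

/-- `{T - u : T ∈ C, u ∈ J}`. -/
def flowBox (C : Set (Hull Q)) (J : Set ℝ) : Set (Hull Q) :=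
  {T | ∃ T₀ ∈ C, ∃ u ∈ J, T = shift u T₀}

/-- A vertical: a set `C - u` with `C` a clopen piece of the transversal with return time `L` and
`u ∈ [0, L[`. -/
def IsVertical (W : Set (Hull Q)) : Prop :=
  ∃ (C : Set (Hull Q)) (L : ℝ), IsClopenPiece C L ∧ ∃ u ∈ Set.Ico 0 L, W = shift u '' C

/-- The number `ε > 0` is small enough for radius `S`: whenever `Q - x` and `Q - y` are in one
vertical of diameter smaller than `ε`, then `Q` looks the same in `B_S(x)` and in `B_S(y)`. -/
def IsAdmissible (Q : Set ℝ) (S ε : ℝ) : Prop :=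
  0 < ε ∧ ∀ W : Set (Hull Q), IsVertical W → Metric.diam W < ε →
    ∀ x y : ℝ, ofReal Q x ∈ W → ofReal Q y ∈ W → localPatch Q S x = localPatch Q S y

/-- The transverse measure `ν(C) = μ({T - u : T ∈ C, u ∈ [0, L]}) / L` of a clopen piece `C` with
return time `L`. -/
def transverseMeasure (μ : Measure (Hull Q)) (C : Set (Hull Q)) (L : ℝ) : ℝ :=
  μ.real (flowBox C (Set.Icc 0 L)) / L

end Hull

open Hull

/-- A Kakutani-Rohlin towers system whose floors have diameter smaller than `ε`. -/
structure TowerSystem (Q : Set ℝ) (ε : ℝ) where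
  /-- the clopen set `𝒞` -/
  base : Set (Hull Q)
  /-- the return time to the transversal on `𝒞` -/
  step : ℝ
  isClopenPiece : IsClopenPiece base step
  nonempty : base.Nonempty
  diam_lt : Metric.diam base < ε
  /-- the number of towers -/
  r : ℕ
  /-- the bases of the towers -/
  E : Fin r → Set (Hull Q)
  isClopen_E : ∀ j, IsClopen ((↑) ⁻¹' (E j) : Set (transversal Q))
  nonempty_E : ∀ j, (E j).Nonempty
  disjoint_E : Pairwise fun i j => Disjoint (E i) (E j)
  iUnion_E : ⋃ j, E j = base
  /-- the heights of the towers -/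
  height : Fin r → ℝ
  returnTime_eq : ∀ j, ∀ T ∈ E j, returnTime base T = height j
  floors : ∀ j, ∀ u ∈ Set.Ico 0 (height j),
    IsVertical (shift u '' E j) ∧ Metric.diam (shift u '' E j) < ε

/-- The `j`-th tower. -/
def TowerSystem.tower {Q : Set ℝ} {ε : ℝ} (K : TowerSystem Q ε) (j : Fin K.r) :
    Set (Hull Q) :=
  flowBox (K.E j) (Set.Ico 0 (K.height j))

/-- The measure `ν_j` of the base of the `j`-th tower. -/
def TowerSystem.nu {Q : Set ℝ} {ε : ℝ} (K : TowerSystem Q ε) (μ : Measure (Hull Q))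
    (j : Fin K.r) : ℝ :=
  transverseMeasure μ (K.E j) K.step

/-- A nested sequence of Kakutani-Rohlin towers systems of sizes `S 0, S 1, …` around a point
`x₀` of the canonical transversal. -/
structure TowerSequence (Q : Set ℝ) (ε : ℝ → ℝ) (S : ℕ → ℝ) where
  x₀ : Hull Q
  mem_transversal : x₀ ∈ transversal Q
  sys : ∀ l, TowerSystem Q (ε (S l))
  /-- the index of the tower whose base contains `x₀` -/
  first : ∀ l, Fin (sys l).r
  mem_first : ∀ l, x₀ ∈ (sys l).E (first l)
  nested : ∀ l, (sys (l + 1)).base ⊆ (sys l).E (first l)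
  crossing : ∀ l i j, ((sys (l + 1)).tower j ∩ (sys l).tower i).Nonempty

/-- The set `ℱ` of the numbers `1 / ∑_j N_j ν_{l,j}` with `l ≥ 0` and positive integers `N_j`. -/
def rotationSet {Q : Set ℝ} {ε : ℝ → ℝ} {S : ℕ → ℝ} (K : TowerSequence Q ε S)
    (μ : Measure (Hull Q)) : Set ℝ :=
  {ρ | ∃ (l : ℕ) (N : Fin (K.sys l).r → ℕ), (∀ j, 0 < N j) ∧
    ρ = 1 / ∑ j, (N j : ℝ) * (K.sys l).nu μ j}

end

/-!
Every positive number is the rotation number of a minimal configuration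
(`exists_isMinimalConfiguration_hasRotationNumber`), so that the set `ℱ` only matters for its
position in the half-line.

*Existence.* For finitely many atoms with fixed ends `a < b`, minimize the energy among the paths
which stay in `[a, b]`; the minimum exists by compactness. Since `U` is strictly convex, two bonds
which are nested lose energy when they exchange their ends (`exchange_lt`). Together with the
Euler-Lagrange equation, which excludes crossings at a common atom, this is Aubry's lemma, and it
gives two facts about a minimal path. It is monotone (`IsMinPath.monotone`). If `V` is the same, up
to a translation, in two disjoint intervals, then the numbers of atoms in them differ by at most two
(`IsMinPath.atomCount_translate_le`): otherwise the two pieces, seen in one frame, cross for two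
consecutive alignments of their indices, and exchanging the blocks between the crossings moves an
atom from the dense piece to the sparse one.

The windows of `K` consecutive atoms of the quasicrystal have finitely many types, with uniform and
positive frequencies. Summing the number of atoms of a minimal path over all windows in a long
interval counts each atom about `K` times, with an error of at most two for each window. Hence, for
large `K`, the density of a minimal path is nearly the same in all long intervals
(`exists_atomCount_compare`), and so it is nearly the mean density, which is prescribed
(`exists_atomCount_density`). A limit of longer and longer minimal paths, recentred at the origin,
is then a minimal configuration with the prescribed rotation number.

*Position of `ℱ`.* Put `σ l = ∑ j, ν_{l,j}`, which is the transverse measure of the base of the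
`l`-th system. It is positive because every orbit of the flow meets the base (`exists_shift_mem`),
so that countably many translates of the flow box over the base cover the hull. It tends to `0`:
two points of the base at distance `h` on an orbit give a period `h` of the quasicrystal in a ball
of radius `S l`; there are finitely many differences of atoms `h` in a bounded range, and none of
them can be a period in arbitrarily large balls, because the quasicrystal is repetitive and not a
crystal. So the return times to the bases tend to infinity, and many disjoint translates of the flow
box fit in the hull (`eventually_sum_nu_lt`). Already the numbers `1 / (N * σ l)` are dense.
-/

open Set Filter Topology MeasureTheory

noncomputable section

/-! ### Paths in a box and their energy -/

/-- The energy of the bond from `x` to `y`. -/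
def bondEnergy (U V : ℝ → ℝ) (x y : ℝ) : ℝ := U (x - y) + V x

/-- The energy of the bonds of `φ` with index in `[i, j)`. -/
def pathEnergy (U V : ℝ → ℝ) (φ : ℕ → ℝ) (i j : ℕ) : ℝ :=
  ∑ t ∈ Finset.Ico i j, bondEnergy U V (φ t) (φ (t + 1))

/-- There is a path with `k` bonds from `x` to `y`, with all its atoms in `B` and energy `e`. -/
def Reach (U V : ℝ → ℝ) (B : Set ℝ) (k : ℕ) (x y e : ℝ) : Prop :=
  ∃ φ : ℕ → ℝ, φ 0 = x ∧ φ k = y ∧ (∀ j ≤ k, φ j ∈ B) ∧ pathEnergy U V φ 0 k = e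

theorem pathEnergy_consecutive (U V : ℝ → ℝ) (φ : ℕ → ℝ) {i j k : ℕ} (hij : i ≤ j) (hjk : j ≤ k) :
    pathEnergy U V φ i j + pathEnergy U V φ j k = pathEnergy U V φ i k :=
  Finset.sum_Ico_consecutive _ hij hjk

theorem pathEnergy_self (U V : ℝ → ℝ) (φ : ℕ → ℝ) (i : ℕ) : pathEnergy U V φ i i = 0 := by
  simp [pathEnergy]

theorem pathEnergy_succ (U V : ℝ → ℝ) (φ : ℕ → ℝ) (i : ℕ) :
    pathEnergy U V φ i (i + 1) = bondEnergy U V (φ i) (φ (i + 1)) := by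
  simp [pathEnergy]

theorem pathEnergy_succ_left (U V : ℝ → ℝ) (φ : ℕ → ℝ) {i k : ℕ} (h : i + 1 ≤ k) :
    bondEnergy U V (φ i) (φ (i + 1)) + pathEnergy U V φ (i + 1) k = pathEnergy U V φ i k := by
  rw [← pathEnergy_succ, pathEnergy_consecutive U V φ (Nat.le_succ i) h]

theorem pathEnergy_succ_right (U V : ℝ → ℝ) (φ : ℕ → ℝ) {i k : ℕ} (h : i ≤ k) :
    pathEnergy U V φ i k + bondEnergy U V (φ k) (φ (k + 1)) = pathEnergy U V φ i (k + 1) := by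
  rw [← pathEnergy_succ, pathEnergy_consecutive U V φ h (Nat.le_succ k)]

namespace Reach

variable {U V : ℝ → ℝ} {B : Set ℝ}

theorem trans {k m : ℕ} {x y z e e' : ℝ} (h : Reach U V B k x y e) (h' : Reach U V B m y z e') :
    Reach U V B (k + m) x z (e + e') := by
  obtain ⟨φ, h0, hk, hB, rfl⟩ := h
  obtain ⟨ψ, h0', hm, hB', rfl⟩ := h'
  have hle : ∀ t ≤ k, (fun j => if j ≤ k then φ j else ψ (j - k)) t = φ t :=
    fun t ht => if_pos ht
  have hge : ∀ t, (fun j => if j ≤ k then φ j else ψ (j - k)) (k + t) = ψ t := by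
    intro t
    rcases Nat.eq_zero_or_pos t with rfl | ht
    · simp [hk, h0']
    · simp only [if_neg (show ¬ k + t ≤ k by omega), Nat.add_sub_cancel_left]
  refine ⟨fun j => if j ≤ k then φ j else ψ (j - k), ?_, ?_, ?_, ?_⟩
  · simpa using h0
  · rw [hge, hm]
  · intro j hj
    rcases le_total j k with h | h
    · rw [hle j h]; exact hB j h
    · obtain ⟨t, rfl⟩ := Nat.exists_eq_add_of_le h
      rw [hge]; exact hB' t (by omega)
  · rw [← pathEnergy_consecutive U V _ (Nat.zero_le k) (Nat.le_add_right k m)]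
    congr 1
    · refine Finset.sum_congr rfl fun t ht => ?_
      have := (Finset.mem_Ico.1 ht).2
      rw [hle t (by omega), hle (t + 1) (by omega)]
    · unfold pathEnergy
      rw [Finset.sum_Ico_eq_sum_range, Finset.sum_Ico_eq_sum_range]
      refine Finset.sum_congr (by simp) fun t _ => ?_
      rw [hge, add_assoc, hge, zero_add]

theorem step {x y : ℝ} (hx : x ∈ B) (hy : y ∈ B) : Reach U V B 1 x y (bondEnergy U V x y) := by
  refine ⟨fun j => if j = 0 then x else y, by simp, by simp, ?_, by simp [pathEnergy]⟩
  intro j _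
  by_cases h : j = 0 <;> simp [h, hx, hy]

theorem of_path (φ : ℕ → ℝ) {i j k : ℕ} (hk : i + k = j) (hB : ∀ t, i ≤ t → t ≤ j → φ t ∈ B) :
    Reach U V B k (φ i) (φ j) (pathEnergy U V φ i j) := by
  refine ⟨fun t => φ (i + t), by simp, by simp [hk], fun t ht => hB _ (by omega) (by omega), ?_⟩
  unfold pathEnergy
  rw [Finset.sum_Ico_eq_sum_range, Finset.sum_Ico_eq_sum_range]
  refine Finset.sum_congr (congrArg _ (by omega)) fun t _ => ?_
  simp [add_assoc]

/-- A piece of a path may be moved by `τ` at the same energy when the potential is the same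
along the moved piece. -/
theorem of_translate (φ : ℕ → ℝ) (τ : ℝ) {i j k : ℕ} (hk : i + k = j)
    (hB : ∀ t, i ≤ t → t ≤ j → φ t + τ ∈ B) (hV : ∀ t, i ≤ t → t < j → V (φ t + τ) = V (φ t)) :
    Reach U V B k (φ i + τ) (φ j + τ) (pathEnergy U V φ i j) := by
  have h := of_path (U := U) (V := V) (fun t => φ t + τ) hk hB
  have he : pathEnergy U V (fun t => φ t + τ) i j = pathEnergy U V φ i j := by
    refine Finset.sum_congr rfl fun t ht => ?_
    have := Finset.mem_Ico.1 ht
    simp [bondEnergy, hV t this.1 this.2]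
  rwa [he] at h

theorem congr {k k' : ℕ} {x y e e' : ℝ} (h : Reach U V B k x y e) (hk : k = k') (he : e = e') :
    Reach U V B k' x y e' := hk ▸ he ▸ h

end Reach

/-- The bonds from `x` to `y'` and from `x'` to `y`, which are nested, lose energy when they exchange
their ends. -/
theorem exchange_lt {U : ℝ → ℝ} (hU : StrictConvexOn ℝ univ U) {x x' y y' : ℝ}
    (hx : x < x') (hy : y < y') :
    U (x - y) + U (x' - y') < U (x - y') + U (x' - y) := by
  have hd : 0 < (x' - x) + (y' - y) := by linarith
  have hne : x - y' ≠ x' - y := by intro h; linarith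
  obtain ⟨p, hp⟩ : ∃ p, p = (x' - x) / ((x' - x) + (y' - y)) := ⟨_, rfl⟩
  obtain ⟨q, hq⟩ : ∃ q, q = (y' - y) / ((x' - x) + (y' - y)) := ⟨_, rfl⟩
  have hp0 : 0 < p := hp ▸ div_pos (by linarith) hd
  have hq0 : 0 < q := hq ▸ div_pos (by linarith) hd
  have hpq : p + q = 1 := by rw [hp, hq]; field_simp
  have h1 := hU.2 (mem_univ (x - y')) (mem_univ (x' - y)) hne hp0 hq0 hpq
  have h2 := hU.2 (mem_univ (x - y')) (mem_univ (x' - y)) hne hq0 hp0 (by linarith)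
  have e1 : p * (x - y') + q * (x' - y) = x - y := by rw [hp, hq]; field_simp; ring
  have e2 : q * (x - y') + p * (x' - y) = x' - y' := by rw [hp, hq]; field_simp; ring
  simp only [smul_eq_mul, e1, e2] at h1 h2
  calc _ < _ := add_lt_add h1 h2
    _ = (p + q) * (U (x - y') + U (x' - y)) := by ring
    _ = _ := by rw [hpq, one_mul]

theorem exchange_le {U : ℝ → ℝ} (hU : StrictConvexOn ℝ univ U) {x x' y y' : ℝ}
    (hx : x ≤ x') (hy : y ≤ y') :
    U (x - y) + U (x' - y') ≤ U (x - y') + U (x' - y) := by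
  rcases hx.eq_or_lt with rfl | hx
  · exact (add_comm _ _).le
  rcases hy.eq_or_lt with rfl | hy
  · exact le_rfl
  exact (exchange_lt hU hx hy).le

/-- A discrete intermediate value theorem. -/
theorem exists_last_of_change {P : ℕ → Prop} {i j : ℕ} (hij : i ≤ j) (hi : P i) (hj : ¬ P j) :
    ∃ k, i ≤ k ∧ k < j ∧ P k ∧ ¬ P (k + 1) := by
  by_contra! h
  have : ∀ d, i + d ≤ j → P (i + d) := by
    intro d
    induction d with
    | zero => intro _; exact hi
    | succ d ih => intro hd; exact h (i + d) (by omega) (by omega) (ih (by omega))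
  obtain ⟨d, rfl⟩ := Nat.exists_eq_add_of_le hij
  exact hj (this d le_rfl)

/-! ### Minimal paths in a box -/

/-- `θ 0, …, θ n` goes from `a` to `b` inside `[a, b]` with the least possible energy. -/
structure IsMinPath (U V : ℝ → ℝ) (n : ℕ) (a b : ℝ) (θ : ℕ → ℝ) : Prop where
  start : θ 0 = a
  stop_eq : θ n = b
  mem : ∀ j ≤ n, θ j ∈ Icc a b
  le : ∀ e, Reach U V (Icc a b) n a b e → pathEnergy U V θ 0 n ≤ e

theorem exists_isMinPath {U V : ℝ → ℝ} (hU : Continuous U) (hV : Continuous V) {a b : ℝ}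
    (hab : a ≤ b) {n : ℕ} (hn : 0 < n) : ∃ θ, IsMinPath U V n a b θ := by
  let X : Set (ℕ → ℝ) := (univ.pi fun _ => Icc a b) ∩ ({φ | φ 0 = a} ∩ {φ | φ n = b})
  have hX : IsCompact X := by
    refine (isCompact_univ_pi fun _ => isCompact_Icc).inter_right (IsClosed.inter ?_ ?_)
    · exact isClosed_eq (continuous_apply 0) continuous_const
    · exact isClosed_eq (continuous_apply n) continuous_const
  have hne : X.Nonempty := by
    refine ⟨fun j => if j = 0 then a else b, ?_, by simp, by simp [hn.ne']⟩
    intro j _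
    by_cases h : j = 0 <;> simp [h, hab]
  have hc : Continuous fun φ : ℕ → ℝ => pathEnergy U V φ 0 n := by
    unfold pathEnergy bondEnergy
    fun_prop
  obtain ⟨θ, hθ, hmin⟩ := hX.exists_isMinOn hne hc.continuousOn
  refine ⟨θ, hθ.2.1, hθ.2.2, fun j _ => hθ.1 j (mem_univ j), ?_⟩
  rintro e ⟨φ, h0, hφn, hB, rfl⟩
  have hφ : (fun j => φ (min j n)) ∈ X := by
    refine ⟨fun j _ => hB _ (min_le_right _ _), by simpa using h0, by simpa using hφn⟩
  refine (hmin hφ).trans (le_of_eq (Finset.sum_congr rfl fun t ht => ?_))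
  have := (Finset.mem_Ico.1 ht).2
  simp only [min_eq_left this.le, min_eq_left (show t + 1 ≤ n from this)]

namespace IsMinPath

variable {U V : ℝ → ℝ} {n : ℕ} {a b : ℝ} {θ : ℕ → ℝ}

theorem reach_sub (h : IsMinPath U V n a b θ) {i j k : ℕ} (hk : i + k = j) (hj : j ≤ n) :
    Reach U V (Icc a b) k (θ i) (θ j) (pathEnergy U V θ i j) :=
  Reach.of_path θ hk fun t _ ht => h.mem t (ht.trans hj)

/-- A descent is followed by a block of atoms at a local minimum `y`; that block costs less when it
is inserted in an earlier bond which climbs across `y`. -/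
theorem monotone (hU : StrictConvexOn ℝ univ U) (h : IsMinPath U V n a b θ) :
    ∀ i j, i ≤ j → j ≤ n → θ i ≤ θ j := by
  suffices hs : ∀ m < n, θ m ≤ θ (m + 1) by
    intro i j hij
    induction j, hij using Nat.le_induction with
    | base => intro _; exact le_rfl
    | succ j _ ih => intro hj; exact (ih (by omega)).trans (hs j (by omega))
  by_contra! hdesc
  classical
  obtain ⟨m, hm, hmax⟩ := ((Finset.range n).filter fun m => θ (m + 1) < θ m).exists_max_image id
    (by obtain ⟨m, h1, h2⟩ := hdesc; exact ⟨m, by simp [h1, h2]⟩)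
  simp only [Finset.mem_filter, Finset.mem_range, id, and_imp] at hm hmax
  have hup : ∀ t, m + 1 ≤ t → t ≤ n → θ (m + 1) ≤ θ t := by
    intro t ht
    induction t, ht using Nat.le_induction with
    | base => intro _; exact le_rfl
    | succ t ht ih =>
      intro htn
      refine (ih (by omega)).trans ?_
      by_contra! hlt
      have := hmax t (by omega) hlt
      omega
  have hmn := (h.mem m hm.1.le)
  have hm1 := (h.mem (m + 1) hm.1)
  obtain ⟨k, hk1, hkn, hk, hk'⟩ := exists_last_of_change (P := fun t => θ t ≤ θ (m + 1)) hm.1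
    le_rfl (by rw [h.stop_eq, not_le]; exact hm.2.trans_le hmn.2)
  obtain ⟨j, -, hjm, hj, hj'⟩ := exists_last_of_change (P := fun t => θ t ≤ θ (m + 1))
    (Nat.zero_le m) (by rw [h.start]; exact hm1.1) (not_le.2 hm.2)
  simp only [not_le] at hk' hj' hk hj
  have hky : θ k = θ (m + 1) := le_antisymm hk (hup k hk1 hkn.le)
  have key := ((((((h.reach_sub (zero_add j) (by omega)).trans
    (Reach.step (h.mem j (by omega)) hm1)).trans
    (h.reach_sub (i := m + 1) (j := k) (k := k - (m + 1)) (by omega) hkn.le)).trans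
    (Reach.step (h.mem k hkn.le) (h.mem (j + 1) (by omega)))).trans
    (h.reach_sub (i := j + 1) (j := m) (k := m - (j + 1)) (by omega) hm.1.le)).trans
    (Reach.step hmn (h.mem (k + 1) (by omega)))).trans
    (h.reach_sub (i := k + 1) (j := n) (k := n - (k + 1)) (by omega) le_rfl)
  rw [h.start, h.stop_eq] at key
  have hle := h.le _ (key.congr (by omega) rfl)
  have e1 := pathEnergy_consecutive U V θ (Nat.zero_le j) (show j ≤ n by omega)
  have e2 := pathEnergy_consecutive U V θ (Nat.le_succ j) (show j + 1 ≤ n by omega)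
  have e3 := pathEnergy_consecutive U V θ (show j + 1 ≤ m by omega) hm.1.le
  have e4 := pathEnergy_consecutive U V θ (Nat.le_succ m) (show m + 1 ≤ n by omega)
  have e5 := pathEnergy_consecutive U V θ hk1 hkn.le
  have e6 := pathEnergy_consecutive U V θ (Nat.le_succ k) (show k + 1 ≤ n by omega)
  simp only [Nat.succ_eq_add_one, pathEnergy_succ] at e2 e4 e6
  have x1 := exchange_le hU hj hj'.le
  have x2 := exchange_lt hU hm.2 hk'
  simp only [bondEnergy, hky] at *
  linarith

/-- The Euler-Lagrange equation at a corner of a path whose energy is minimal. -/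
theorem corner (hU : Differentiable ℝ U) (hV : Differentiable ℝ V) (h : IsMinPath U V n a b θ)
    {k k' : ℕ} {x c y e e' : ℝ} (h1 : Reach U V (Icc a b) k a x e)
    (h2 : Reach U V (Icc a b) k' y b e') (hk : k + 2 + k' = n) (hx : x ∈ Icc a b)
    (hy : y ∈ Icc a b) (hc : c ∈ Ioo a b)
    (he : e + bondEnergy U V x c + bondEnergy U V c y + e' ≤ pathEnergy U V θ 0 n) :
    deriv U (x - c) = deriv V c + deriv U (c - y) := by
  have hmin : IsLocalMin (fun z => U (x - z) + (U (z - y) + V z)) c := by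
    filter_upwards [Ioo_mem_nhds hc.1 hc.2] with z hz
    have hz' := Ioo_subset_Icc_self hz
    have := h.le _ ((((h1.trans (Reach.step hx hz')).trans (Reach.step hz' hy)).trans h2).congr
      (by omega) rfl)
    simp only [bondEnergy] at this he
    linarith
  have hd : HasDerivAt (fun z => U (x - z) + (U (z - y) + V z))
      (deriv U (x - c) * (-1) + (deriv U (c - y) * 1 + deriv V c)) c := by
    refine HasDerivAt.add ?_ (HasDerivAt.add ?_ (hV c).hasDerivAt)
    · exact (hU (x - c)).hasDerivAt.comp c ((hasDerivAt_id c).const_sub x)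
    · exact (hU (c - y)).hasDerivAt.comp c ((hasDerivAt_id c).sub_const y)
  have := hmin.hasDerivAt_eq_zero hd
  linarith

end IsMinPath

/-! ### Counting the atoms of a minimal path -/

/-- The number of atoms among `θ 0, …, θ n` lying strictly to the left of `x`. -/
def atomCount (θ : ℕ → ℝ) (n : ℕ) (x : ℝ) : ℕ :=
  ((Finset.range (n + 1)).filter fun k => θ k < x).card

theorem atomCount_le (θ : ℕ → ℝ) (n : ℕ) (x : ℝ) : atomCount θ n x ≤ n + 1 :=
  (Finset.card_filter_le _ _).trans (Finset.card_range _).le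

theorem atomCount_mono (θ : ℕ → ℝ) (n : ℕ) : Monotone (atomCount θ n) := by
  intro x y hxy
  exact Finset.card_le_card (Finset.monotone_filter_right _ fun k _ hk => lt_of_lt_of_le hk hxy)

theorem lt_atomCount_iff {θ : ℕ → ℝ} {n : ℕ} (hθ : ∀ i j, i ≤ j → j ≤ n → θ i ≤ θ j) {k : ℕ}
    (hk : k ≤ n) {x : ℝ} : k < atomCount θ n x ↔ θ k < x := by
  constructor
  · intro h
    by_contra! hx
    have : (Finset.range (n + 1)).filter (fun k => θ k < x) ⊆ Finset.range k := by
      intro j hj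
      simp only [Finset.mem_filter, Finset.mem_range] at hj ⊢
      by_contra! hkj
      exact absurd (hx.trans (hθ k j hkj (by omega))) (not_le.2 hj.2)
    have := Finset.card_le_card this
    rw [Finset.card_range] at this
    unfold atomCount at h
    omega
  · intro h
    have : Finset.range (k + 1) ⊆ (Finset.range (n + 1)).filter (fun k => θ k < x) := by
      intro j hj
      simp only [Finset.mem_filter, Finset.mem_range] at hj ⊢
      exact ⟨by omega, (hθ j k (by omega) hk).trans_lt h⟩
    have := Finset.card_le_card this
    rw [Finset.card_range] at this
    exact this

namespace IsMinPath

variable {U V : ℝ → ℝ} {n : ℕ} {a b : ℝ} {θ : ℕ → ℝ}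

theorem reach_start (h : IsMinPath U V n a b θ) {k : ℕ} (hk : k ≤ n) :
    Reach U V (Icc a b) k a (θ k) (pathEnergy U V θ 0 k) :=
  h.start ▸ h.reach_sub (zero_add k) hk

theorem reach_end (h : IsMinPath U V n a b θ) {k : ℕ} (hk : k ≤ n) :
    Reach U V (Icc a b) (n - k) (θ k) b (pathEnergy U V θ k n) :=
  h.stop_eq ▸ h.reach_sub (by omega) le_rfl

/-- Given two pieces of a minimal path, seen in one frame (the second one is moved by `-τ`), which
cross at `i` for one alignment of their indices and at `j ≥ i` for the next alignment, one atom can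
be moved from the second piece to the first one at no cost, by exchanging the blocks between the
two crossings. The first two paths are the new pieces, the first one without its first bond. -/
theorem exists_swap (hU : StrictConvexOn ℝ univ U) (h : IsMinPath U V n a b θ) {x₀ x₁ τ : ℝ}
    (hax : a < x₀) (hxb : x₁ ≤ b) (hVτ : ∀ x ∈ Ico x₀ x₁, V (x + τ) = V x) {p q i j : ℕ}
    (hij : i ≤ j) (hp : p + j + 1 ≤ n) (hq : q + j + 2 ≤ n)
    (hA : ∀ t, i + 1 ≤ t → t ≤ j → θ (p + t) ∈ Ico x₀ x₁)
    (hB : ∀ t, t ≤ j + 2 → θ (q + t) ∈ Ico (x₀ + τ) (x₁ + τ))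
    (hi : θ (p + i) ≤ θ (q + i) - τ) (hi' : θ (q + i + 1) - τ < θ (p + i + 1))
    (hj : θ (p + j) ≤ θ (q + j + 1) - τ) (hj' : θ (q + j + 2) - τ < θ (p + j + 1)) :
    ∃ e e', Reach U V (Icc a b) (j - i + 1) (θ (q + i + 1) - τ) (θ (p + j + 1)) e ∧
      Reach U V (Icc a b) (j - i + 1) (θ (q + i)) (θ (q + j + 2)) e' ∧
      bondEnergy U V (θ (p + i)) (θ (q + i + 1) - τ) + e + e' ≤
        pathEnergy U V θ (p + i) (p + j + 1) + pathEnergy U V θ (q + i) (q + j + 2) ∧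
      (θ (p + i) < θ (q + i) - τ →
        bondEnergy U V (θ (p + i)) (θ (q + i + 1) - τ) + e + e' <
          pathEnergy U V θ (p + i) (p + j + 1) + pathEnergy U V θ (q + i) (q + j + 2)) := by
  have hmono := h.monotone hU
  have hB' : ∀ t, t ≤ j + 2 → θ (q + t) - τ ∈ Ico x₀ x₁ := fun t ht =>
    ⟨by linarith [(hB t ht).1], by linarith [(hB t ht).2]⟩
  have hsub : ∀ x ∈ Ico x₀ x₁, x ∈ Icc a b := fun x hx => ⟨hax.le.trans hx.1, hx.2.le.trans hxb⟩
  have hVB : ∀ t, t ≤ j + 2 → V (θ (q + t) - τ) = V (θ (q + t)) := fun t ht => by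
    have := hVτ _ (hB' t ht)
    rwa [sub_add_cancel, eq_comm] at this
  have r1 : Reach U V (Icc a b) (j - i) (θ (q + i + 1) - τ) (θ (q + j + 1) - τ)
      (pathEnergy U V θ (q + i + 1) (q + j + 1)) := by
    refine Reach.of_translate θ (-τ) (by omega) (fun t h1 h2 => ?_) (fun t h1 h2 => ?_)
    · obtain ⟨s, rfl⟩ := Nat.exists_eq_add_of_le (show q ≤ t by omega)
      exact hsub _ (hB' s (by omega))
    · obtain ⟨s, rfl⟩ := Nat.exists_eq_add_of_le (show q ≤ t by omega)
      exact hVB s (by omega)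
  have r2 := r1.trans (Reach.step (hsub _ (hB' (j + 1) (by omega))) (h.mem (p + j + 1) hp))
  have x1 : θ (p + i) < θ (q + i) - τ →
      U (θ (p + i) - (θ (q + i + 1) - τ)) + U (θ (q + i) - τ - θ (p + i + 1)) <
      U (θ (p + i) - θ (p + i + 1)) + U (θ (q + i) - τ - (θ (q + i + 1) - τ)) :=
    fun hlt => exchange_lt hU hlt hi'
  have x1' := exchange_le hU hi hi'.le
  rw [sub_sub_sub_cancel_right] at x1
  rw [sub_sub_sub_cancel_right] at x1'
  have v1 : V (θ (q + j + 1) - τ) = V (θ (q + j + 1)) := hVB (j + 1) (by omega)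
  have e1 := pathEnergy_succ_left U V θ (show q + i + 1 ≤ q + j + 2 by omega)
  have e2 : _ = pathEnergy U V θ (q + i + 1) (q + j + 2) :=
    pathEnergy_succ_right U V θ (show q + i + 1 ≤ q + j + 1 by omega)
  rcases hij.eq_or_lt with rfl | hlt
  · refine ⟨_, bondEnergy U V (θ (q + i)) (θ (q + i + 2)), r2, ?_, ?_⟩
    · rw [Nat.sub_self]
      exact Reach.step (h.mem _ (by omega)) (h.mem _ hq)
    · have hBi : θ (q + i) - τ ≤ θ (q + i + 1) - τ :=
        sub_le_sub_right (hmono (q + i) (q + i + 1) (by omega) (by omega)) τ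
      have x2 := exchange_le hU hBi hj'.le
      rw [sub_sub_sub_cancel_right, sub_sub_sub_cancel_right] at x2
      have e3 := pathEnergy_succ U V θ (p + i)
      simp only [pathEnergy_self] at e2 ⊢
      simp only [bondEnergy] at *
      refine ⟨by linarith, fun hlt => ?_⟩
      have := x1 hlt
      linarith
  · have hmem : ∀ t, i + 1 ≤ t → t ≤ j → θ (p + t) + τ ∈ Icc a b := by
      intro t h1 h2
      have l1 := hmono (p + i + 1) (p + t) (by omega) (by omega)
      have l2 := hmono (p + t) (p + j) (by omega) (by omega)
      have l3 := (h.mem (q + i + 1) (by omega)).1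
      have l4 := (h.mem (q + j + 1) (by omega)).2
      constructor <;> linarith
    have r3 : Reach U V (Icc a b) (j - (i + 1)) (θ (p + i + 1) + τ) (θ (p + j) + τ)
        (pathEnergy U V θ (p + i + 1) (p + j)) := by
      refine Reach.of_translate θ τ (by omega) (fun t h1 h2 => ?_) (fun t h1 h2 => ?_)
      · obtain ⟨s, rfl⟩ := Nat.exists_eq_add_of_le (show p ≤ t by omega)
        exact hmem s (by omega) (by omega)
      · obtain ⟨s, rfl⟩ := Nat.exists_eq_add_of_le (show p ≤ t by omega)
        exact hVτ _ (hA s (by omega) (by omega))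
    have r4 := ((Reach.step (h.mem (q + i) (by omega)) (hmem (i + 1) le_rfl hlt)).trans r3).trans
      (Reach.step (hmem j hlt le_rfl) (h.mem (q + j + 2) hq))
    refine ⟨_, _, r2, r4.congr (by omega) rfl, ?_⟩
    have x2 := exchange_le hU hj hj'.le
    rw [sub_sub_sub_cancel_right] at x2
    have v2 := hVτ _ (hA j hlt le_rfl)
    have e3 := pathEnergy_succ_left U V θ (show p + i + 1 ≤ p + j + 1 by omega)
    have e4 := pathEnergy_succ_right U V θ (show p + i + 1 ≤ p + j by omega)
    have a1 : θ (q + i) - (θ (p + i + 1) + τ) = θ (q + i) - τ - θ (p + i + 1) := by ring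
    have a2 : θ (p + j) + τ - θ (q + j + 2) = θ (p + j) - (θ (q + j + 2) - τ) := by ring
    simp only [← add_assoc, bondEnergy] at *
    simp only [a1, a2, v1, v2]
    refine ⟨by linarith, fun hlt => ?_⟩
    have := x1 hlt
    linarith

/-- A minimal path has at most two atoms more in an interval than in a disjoint translated copy of
it in which the potential is the same. -/
theorem atomCount_translate_le (hU : StrictConvexOn ℝ univ U) (hUd : Differentiable ℝ U)
    (hU' : StrictMono (deriv U)) (hVd : Differentiable ℝ V) (h : IsMinPath U V n a b θ)
    {x₀ x₁ τ : ℝ} (hax : a < x₀) (hx : x₀ ≤ x₁) (hxb : x₁ ≤ b)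
    (hVτ : ∀ x ∈ Ico x₀ x₁, V (x + τ) = V x) (hdisj : x₁ ≤ x₀ + τ ∨ x₁ + τ ≤ x₀) :
    atomCount θ n (x₁ + τ) + atomCount θ n x₀ ≤
      atomCount θ n (x₀ + τ) + atomCount θ n x₁ + 2 := by
  by_contra! hcon
  have hmono := h.monotone hU
  have hN : ∀ {k : ℕ} {x : ℝ}, k ≤ n → (k < atomCount θ n x ↔ θ k < x) :=
    fun hk => lt_atomCount_iff hmono hk
  obtain ⟨p, hp⟩ : ∃ p, atomCount θ n x₀ = p + 1 :=
    Nat.exists_eq_succ_of_ne_zero ((hN (Nat.zero_le n)).2 (by rwa [h.start])).ne'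
  obtain ⟨m, hm⟩ := Nat.exists_eq_add_of_le (atomCount_mono θ n hx)
  obtain ⟨q, hq⟩ : ∃ q, atomCount θ n (x₀ + τ) = q := ⟨_, rfl⟩
  have hqn := atomCount_le θ n (x₁ + τ)
  have hpn : p + 1 + m ≤ n := by
    have : ¬ n < atomCount θ n x₁ := by
      rw [hN le_rfl, h.stop_eq]; exact not_lt.2 hxb
    omega
  have hA : ∀ t, 1 ≤ t → t ≤ m → θ (p + t) ∈ Ico x₀ x₁ := fun t h1 h2 =>
    ⟨not_lt.1 ((hN (by omega)).not.1 (by omega)), (hN (by omega)).1 (by omega)⟩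
  have hB : ∀ t, t ≤ m + 2 → θ (q + t) ∈ Ico (x₀ + τ) (x₁ + τ) := fun t h2 =>
    ⟨not_lt.1 ((hN (by omega)).not.1 (by omega)), (hN (by omega)).1 (by omega)⟩
  have hA0 : θ p < x₀ := (hN (by omega)).1 (by omega)
  have hA1 : x₁ ≤ θ (p + (m + 1)) := not_lt.1 ((hN (by omega)).not.1 (by omega))
  obtain ⟨i, -, him, hi, hi'⟩ := exists_last_of_change (Nat.zero_le (m + 1))
    (P := fun t => θ (p + t) ≤ θ (q + t) - τ)
    (by have := (hB 0 (by omega)).1; simp only [add_zero] at this ⊢; linarith)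
    (by have := (hB (m + 1) (by omega)).2; linarith)
  obtain ⟨j, hij, hjm, hj, hj'⟩ := exists_last_of_change him.le
    (P := fun t => θ (p + t) ≤ θ (q + t + 1) - τ)
    (by have := hmono (q + i) (q + i + 1) (by omega) (by omega); linarith)
    (by have := (hB (m + 1 + 1) (by omega)).2; simp only [← add_assoc] at *; linarith)
  simp only [← add_assoc, not_le] at hi hi' hj hj'
  obtain ⟨e, e', r1, r2, hle, hlt⟩ := h.exists_swap hU hax hxb hVτ hij (by omega) (by omega)
    (fun t h1 h2 => hA t (by omega) (by omega)) (fun t ht => hB t (by omega)) hi hi' hj hj'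
  -- The order of the two intervals decides in which order the new pieces are assembled.
  have hpq : p + j + 1 ≤ q + i ∨ q + j + 2 ≤ p := by
    rcases hdisj with hd | hd
    · have := atomCount_mono θ n hd
      omega
    · have := atomCount_mono θ n hd
      omega
  have hpj : p + j + 1 ≤ n := by omega
  have hqj : q + j + 2 ≤ n := by omega
  have hBm : θ (q + i + 1) - τ ∈ Icc a b := by
    have := hB (i + 1) (by omega)
    rw [← add_assoc] at this
    constructor <;> linarith [this.1, this.2]
  have hsum : ∀ {x y z : ℕ}, x ≤ y → y ≤ z →
      pathEnergy U V θ x y + pathEnergy U V θ y z = pathEnergy U V θ x z :=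
    fun h1 h2 => pathEnergy_consecutive U V θ h1 h2
  have hasm : ∀ s, p ≤ s → s ≤ p + i → ∃ k k' E E', Reach U V (Icc a b) k a (θ s) E ∧
      Reach U V (Icc a b) k' (θ (q + i + 1) - τ) b E' ∧ k + (p + i - s) + 1 + k' = n ∧
      E + pathEnergy U V θ s (p + i) + bondEnergy U V (θ (p + i)) (θ (q + i + 1) - τ) + E' ≤
        pathEnergy U V θ 0 n ∧
      (θ (p + i) < θ (q + i) - τ →
        E + pathEnergy U V θ s (p + i) + bondEnergy U V (θ (p + i)) (θ (q + i + 1) - τ) + E' <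
        pathEnergy U V θ 0 n) := by
    intro s hps hsi
    have s1 := hsum hsi (show p + i ≤ p + j + 1 by omega)
    rcases hpq with hpq | hpq
    · refine ⟨s, _, _, _, h.reach_start (by omega), (r1.trans (h.reach_sub
        (k := q + i - (p + j + 1)) (by omega) (by omega))).trans (r2.trans
        (h.reach_end hqj)), by omega, ?_⟩
      have s2 := hsum (Nat.zero_le s) (show s ≤ p + j + 1 by omega)
      have s3 := hsum (Nat.zero_le (p + j + 1)) hpq
      have s4 := hsum (Nat.zero_le (q + i)) (show q + i ≤ q + j + 2 by omega)
      have s5 := hsum (Nat.zero_le (q + j + 2)) hqj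
      refine ⟨by linarith, fun hs => ?_⟩
      have := hlt hs
      linarith
    · refine ⟨_, _, _, _, (h.reach_start (by omega)).trans (r2.trans (h.reach_sub
        (k := s - (q + j + 2)) (by omega) (by omega))), r1.trans (h.reach_end hpj), by omega, ?_⟩
      have s2 := hsum (Nat.zero_le (q + i)) (show q + i ≤ q + j + 2 by omega)
      have s3 := hsum (Nat.zero_le (q + j + 2)) (show q + j + 2 ≤ s by omega)
      have s4 := hsum (Nat.zero_le s) (show s ≤ p + j + 1 by omega)
      have s5 := hsum (Nat.zero_le (p + j + 1)) hpj
      refine ⟨by linarith, fun hs => ?_⟩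
      have := hlt hs
      linarith
  rcases hi.eq_or_lt with heq | hstrict
  · -- The pieces share the atom `θ (p + i)`, and two Euler-Lagrange equations hold there.
    have hi0 : i ≠ 0 := by
      rintro rfl
      have := (hB 0 (by omega)).1
      simp only [add_zero] at this heq
      linarith
    obtain ⟨l, hl⟩ := Nat.exists_eq_succ_of_ne_zero hi0
    obtain ⟨c, hc⟩ : ∃ c, c = p + l := ⟨_, rfl⟩
    have hpi : p + i = c + 1 := by omega
    rw [hpi] at hi' heq
    have hcI : θ (c + 1) ∈ Ioo a b := by
      have := hA i (by omega) (by omega)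
      rw [hpi] at this
      exact ⟨hax.trans_le this.1, this.2.trans_le hxb⟩
    obtain ⟨k, k', E, E', t1, t2, hk, hE, -⟩ := hasm c (by omega) (by omega)
    rw [hpi, pathEnergy_succ] at hE
    have c1 := h.corner hUd hVd t1 t2 (by omega) (h.mem _ (by omega)) hBm hcI hE
    have s1 := hsum (Nat.zero_le c) (show c ≤ n by omega)
    have s2 := hsum (Nat.le_succ c) (show c + 1 ≤ n by omega)
    have s3 := hsum (Nat.le_succ (c + 1)) (show c + 1 + 1 ≤ n by omega)
    simp only [Nat.succ_eq_add_one, pathEnergy_succ] at s2 s3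
    have c2 := h.corner hUd hVd (h.reach_start (k := c) (by omega))
      (h.reach_end (k := c + 1 + 1) (by omega)) (by omega) (h.mem _ (by omega))
      (h.mem _ (by omega)) hcI (by linarith)
    have := hU' (show θ (c + 1) - θ (c + 1 + 1) < θ (c + 1) - (θ (q + i + 1) - τ) by linarith)
    linarith
  · obtain ⟨k, k', E, E', t1, t2, hk, -, hE⟩ := hasm (p + i) (by omega) le_rfl
    have := h.le _ (((t1.trans (Reach.step (h.mem _ (by omega)) hBm)).trans t2).congr
      (by omega) rfl)
    have hE := hE hstrict
    rw [pathEnergy_self] at hE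
    linarith

end IsMinPath

/-! ### Geometry of a quasicrystal -/

namespace IsQuasicrystal

variable {s : ℤ → ℝ}

theorem exists_gap_ge (hs : IsQuasicrystal s) : ∃ δ : ℝ, 0 < δ ∧ ∀ n : ℤ, δ ≤ s (n + 1) - s n := by
  classical
  obtain ⟨F, hF⟩ := hs.finiteLocalComplexity 1 one_pos
  obtain ⟨δ, hδ, hmin⟩ := (insert 1 (F.image fun q => s (q.2 + 1) - s q.2)).exists_min_image id
    ⟨1, Finset.mem_insert_self _ _⟩
  have hpos : ∀ n : ℤ, 0 < s (n + 1) - s n := fun n => sub_pos.2 (hs.strictMono (by omega))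
  refine ⟨δ, ?_, fun n => ?_⟩
  · rcases Finset.mem_insert.1 hδ with rfl | h
    · exact one_pos
    · obtain ⟨q, -, rfl⟩ := Finset.mem_image.1 h
      exact hpos _
  · rcases lt_or_ge (s (n + 1) - s n) 1 with h | h
    · obtain ⟨m, hm, τ, hτ⟩ := hF 1 n (by simpa using h)
      have h0 := hτ 0 (by omega)
      have h1 := hτ 1 le_rfl
      have := hmin (s (m + 1) - s m) (Finset.mem_insert_of_mem (Finset.mem_image.2 ⟨_, hm, rfl⟩))
      simp only [id, Nat.cast_zero, add_zero, Nat.cast_one] at *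
      linarith
    · exact (hmin 1 (Finset.mem_insert_self _ _)).trans h

theorem exists_gap_le (hs : IsQuasicrystal s) : ∃ G : ℝ, 0 < G ∧ ∀ n : ℤ, s (n + 1) - s n ≤ G := by
  obtain ⟨R, hR, h⟩ := hs.repetitive 0 0
  refine ⟨2 * R, by linarith, fun n => ?_⟩
  by_contra! hlt
  obtain ⟨m, -, hm⟩ := h ((s n + s (n + 1)) / 2)
  have := hm 0 le_rfl
  simp only [Nat.cast_zero, add_zero, Metric.mem_ball, Real.dist_eq, abs_lt] at this
  rcases le_or_gt m n with hmn | hmn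
  · have := hs.strictMono.monotone hmn
    linarith
  · have := hs.strictMono.monotone (show n + 1 ≤ m by omega)
    linarith

end IsQuasicrystal

theorem mul_le_sub_of_gap_ge {s : ℤ → ℝ} {δ : ℝ} (h : ∀ n : ℤ, δ ≤ s (n + 1) - s n) (n : ℤ)
    (k : ℕ) : k * δ ≤ s (n + k) - s n := by
  induction k with
  | zero => simp
  | succ k ih =>
    have := h (n + k)
    push_cast
    rw [← add_assoc]
    linarith

theorem sub_le_mul_of_gap_le {s : ℤ → ℝ} {G : ℝ} (h : ∀ n : ℤ, s (n + 1) - s n ≤ G) (n : ℤ)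
    (k : ℕ) : s (n + k) - s n ≤ k * G := by
  induction k with
  | zero => simp
  | succ k ih =>
    have := h (n + k)
    push_cast
    rw [← add_assoc]
    linarith

namespace IsQuasicrystal

variable {s : ℤ → ℝ}

theorem exists_le (hs : IsQuasicrystal s) (x : ℝ) : ∃ n, s n ≤ x := by
  obtain ⟨R, hR, h⟩ := hs.repetitive 0 0
  obtain ⟨m, -, hm⟩ := h (x - R)
  have := hm 0 le_rfl
  simp only [Nat.cast_zero, add_zero, Metric.mem_ball, Real.dist_eq, abs_lt] at this
  exact ⟨m, by linarith⟩

theorem exists_ge (hs : IsQuasicrystal s) (x : ℝ) : ∃ n, x ≤ s n := by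
  obtain ⟨R, hR, h⟩ := hs.repetitive 0 0
  obtain ⟨m, -, hm⟩ := h (x + R)
  have := hm 0 le_rfl
  simp only [Nat.cast_zero, add_zero, Metric.mem_ball, Real.dist_eq, abs_lt] at this
  exact ⟨m, by linarith⟩

theorem exists_first_ge (hs : IsQuasicrystal s) (x : ℝ) : ∃ A, ∀ m, x ≤ s m ↔ A ≤ m := by
  obtain ⟨n, hn⟩ := hs.exists_le (x - 1)
  obtain ⟨A, hA, hmin⟩ := Int.exists_least_of_bdd (P := fun m => x ≤ s m)
    ⟨n, fun z hz => (hs.strictMono.lt_iff_lt.1 (by linarith : s n < s z)).le⟩ (hs.exists_ge x)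
  exact ⟨A, fun m => ⟨hmin m, fun h => hA.trans (hs.strictMono.monotone h)⟩⟩

theorem exists_last_le (hs : IsQuasicrystal s) (x : ℝ) : ∃ B, ∀ m, s m ≤ x ↔ m ≤ B := by
  obtain ⟨n, hn⟩ := hs.exists_ge (x + 1)
  obtain ⟨B, hB, hmax⟩ := Int.exists_greatest_of_bdd (P := fun m => s m ≤ x)
    ⟨n, fun z hz => (hs.strictMono.lt_iff_lt.1 (by linarith : s z < s n)).le⟩ (hs.exists_le x)
  exact ⟨B, fun m => ⟨hmax m, fun h => (hs.strictMono.monotone h).trans hB⟩⟩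

end IsQuasicrystal

/-- The pattern of the segment `(s n, …, s (n + p))`, seen from its first atom (and extended by
zero). -/
def pattern (s : ℤ → ℝ) (p : ℕ) (n : ℤ) (i : ℕ) : ℝ := if i ≤ p then s (n + i) - s n else 0

theorem segEquiv_iff_pattern_eq {s : ℤ → ℝ} {p : ℕ} {n m : ℤ} :
    SegEquiv s p n m ↔ pattern s p n = pattern s p m := by
  constructor
  · rintro ⟨τ, h⟩
    funext i
    unfold pattern
    split_ifs with hi
    · have h0 := h 0 (Nat.zero_le _)
      simp only [Nat.cast_zero, add_zero] at h0
      rw [h i hi, h0]; ring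
    · rfl
  · intro h
    refine ⟨s m - s n, fun i hi => ?_⟩
    have := congrFun h i
    simp only [pattern, if_pos hi] at this
    linarith

theorem SegEquiv.eq_add {s : ℤ → ℝ} {p : ℕ} {n m : ℤ} (h : SegEquiv s p n m) {i : ℕ} (hi : i ≤ p) :
    s (m + i) = s (n + i) + (s m - s n) := by
  have := congrFun (segEquiv_iff_pattern_eq.1 h) i
  simp only [pattern, if_pos hi] at this
  linarith

theorem SegEquiv.symm {s : ℤ → ℝ} {p : ℕ} {n m : ℤ} (h : SegEquiv s p n m) : SegEquiv s p m n :=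
  segEquiv_iff_pattern_eq.2 (segEquiv_iff_pattern_eq.1 h).symm

open Classical in
theorem segCount_eq_card {s : ℤ → ℝ} {p : ℕ} {x M : ℝ} {A B : ℤ}
    (h : ∀ m, (∀ i : ℕ, i ≤ p → s (m + i) ∈ Icc x (x + M)) ↔ m ∈ Finset.Icc A (B - p)) (n : ℤ) :
    segCount s p n x M =
      ((Finset.Icc A (B - p)).filter fun m => pattern s p m = pattern s p n).card := by
  rw [segCount, ← Set.ncard_coe_finset]
  congr 1
  ext m
  simp only [mem_ofPred_eq, h, segEquiv_iff_pattern_eq, Finset.coe_filter]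
  rw [and_comm, eq_comm]

namespace IsQuasicrystal

variable {s : ℤ → ℝ}

theorem finite_range_pattern (hs : IsQuasicrystal s) (p : ℕ) : (range (pattern s p)).Finite := by
  obtain ⟨G, hG, hgap⟩ := hs.exists_gap_le
  obtain ⟨F, hF⟩ := hs.finiteLocalComplexity (p * G + 1) (by positivity)
  refine ((F.finite_toSet).image fun q => pattern s p q.2).subset ?_
  rintro _ ⟨n, rfl⟩
  obtain ⟨m, hm, he⟩ := hF p n (by linarith [sub_le_mul_of_gap_le hgap n p])
  exact ⟨_, hm, segEquiv_iff_pattern_eq.1 he⟩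

/-- The potential is the same, up to the translation, in the core of equivalent segments; the core
is obtained by removing `w` atoms at both ends. -/
theorem exists_potential_eq (hs : IsQuasicrystal s) {V : ℝ → ℝ} {R : ℝ}
    (hV : HasRange (range s) V R) : ∃ w : ℕ, ∀ (K : ℕ) (n m : ℤ), SegEquiv s (w + K + w) n m →
      ∀ x ∈ Icc (s (n + w)) (s (n + (w + K : ℕ))), V (x + (s m - s n)) = V x := by
  obtain ⟨δ, hδ, hgap⟩ := hs.exists_gap_ge
  obtain ⟨w, hw⟩ := exists_nat_ge (R / δ)
  have hwR : R ≤ w * δ := (div_le_iff₀ hδ).1 hw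
  refine ⟨w, fun K => ?_⟩
  have key : ∀ n m : ℤ, SegEquiv s (w + K + w) n m →
      ∀ x ∈ Icc (s (n + w)) (s (n + (w + K : ℕ))),
      localPatch (range s) R x ⊆ localPatch (range s) R (x + (s m - s n)) := by
    rintro n m h x hx z ⟨⟨k, hk⟩, hz⟩
    rw [Metric.mem_ball, Real.dist_eq, add_sub_cancel_right] at hz
    have h1 := mul_le_sub_of_gap_ge hgap n w
    have h2 := mul_le_sub_of_gap_ge hgap (n + (w + K : ℕ)) w
    have hz' := abs_lt.1 hz
    have l1 : n < k := hs.strictMono.lt_iff_lt.1 (by rw [hk]; linarith [hx.1])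
    have l2 : k < n + (w + K : ℕ) + w :=
      hs.strictMono.lt_iff_lt.1 (by rw [hk]; linarith [hx.2])
    push_cast at l2
    obtain ⟨i, hi⟩ := Int.eq_ofNat_of_zero_le (show 0 ≤ k - n by omega)
    obtain rfl : k = n + i := by omega
    refine ⟨⟨m + i, ?_⟩, ?_⟩
    · rw [h.eq_add (by omega), hk]; ring
    · rwa [Metric.mem_ball, Real.dist_eq, add_sub_cancel_right]
  intro n m h x hx
  refine hV _ _ (Subset.antisymm ?_ (key n m h x hx))
  have e1 := h.eq_add (show w ≤ w + K + w by omega)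
  have e2 := h.eq_add (show w + K ≤ w + K + w by omega)
  have := key m n h.symm (x + (s m - s n)) ⟨by linarith [hx.1], by linarith [hx.2]⟩
  rwa [show x + (s m - s n) + (s n - s m) = x by ring] at this

/-! ### Pattern frequencies -/

/-- The indices of the segments with `p + 1` atoms contained in `[x, x + M]` form an interval. -/
theorem exists_window (hs : IsQuasicrystal s) (p : ℕ) (x M : ℝ) : ∃ A B : ℤ,
    (∀ m, x ≤ s m ↔ A ≤ m) ∧ (∀ m, s m ≤ x + M ↔ m ≤ B) ∧
    ∀ m, (∀ i : ℕ, i ≤ p → s (m + i) ∈ Icc x (x + M)) ↔ m ∈ Finset.Icc A (B - p) := by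
  obtain ⟨A, hA⟩ := hs.exists_first_ge x
  obtain ⟨B, hB⟩ := hs.exists_last_le (x + M)
  refine ⟨A, B, hA, hB, fun m => ?_⟩
  rw [Finset.mem_Icc]
  constructor
  · intro h
    have h0 := (h 0 (Nat.zero_le p)).1
    have h1 := (h p le_rfl).2
    rw [hA] at h0
    rw [hB] at h1
    push_cast at h0
    omega
  · intro h i hi
    exact ⟨(hA _).2 (by omega), (hB _).2 (by omega)⟩

/-- Pattern frequencies are positive, by repetitivity. -/
theorem exists_frequency (hs : IsQuasicrystal s) (p : ℕ) (n : ℤ) : ∃ ν : ℝ, 0 < ν ∧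
    TendstoUniformly (fun (M : ℝ) (x : ℝ) => (segCount s p n x M : ℝ) / M) (fun _ => ν) atTop := by
  obtain ⟨ν, hν⟩ := hs.uniformPatternDistribution p n
  refine ⟨ν, ?_, hν⟩
  obtain ⟨R, hR, hrep⟩ := hs.repetitive p n
  -- `k` consecutive intervals of length `2 * R` contain at least `k` occurrences.
  have hcount : ∀ k : ℕ, k ≤ segCount s p n 0 (k * (2 * R)) := by
    intro k
    obtain ⟨A, B, -, -, h⟩ := hs.exists_window p 0 (k * (2 * R))
    choose f hf hfx using fun i : ℕ => hrep (i * (2 * R) + R)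
    classical
    rw [segCount_eq_card h n]
    have hloc : ∀ i j : ℕ, j ≤ p → i * (2 * R) < s (f i + j) ∧ s (f i + j) < (i + 1) * (2 * R) := by
      intro i j hj
      have := hfx i j hj
      rw [Metric.mem_ball, Real.dist_eq, abs_lt] at this
      constructor <;> linarith [this.1, this.2]
    have hinj : ∀ i j, i < j → f i ≠ f j := by
      intro i j hij he
      have h1 := (hloc i 0 (Nat.zero_le p)).2
      have h2 := (hloc j 0 (Nat.zero_le p)).1
      rw [he] at h1
      have : ((i : ℝ) + 1) ≤ j := by exact_mod_cast hij
      nlinarith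
    calc k = ((Finset.range k).image f).card := by
          rw [Finset.card_image_of_injective, Finset.card_range]
          intro i j hij
          by_contra hne
          rcases Nat.lt_or_gt_of_ne hne with hlt | hlt
          · exact hinj i j hlt hij
          · exact hinj j i hlt hij.symm
      _ ≤ _ := by
          refine Finset.card_le_card fun m hm => ?_
          obtain ⟨i, hi, rfl⟩ := Finset.mem_image.1 hm
          rw [Finset.mem_filter, ← h]
          refine ⟨fun j hj => ?_, (segEquiv_iff_pattern_eq.1 (hf i)).symm⟩
          have := hloc i j hj
          have hik : ((i : ℝ) + 1) ≤ k := by exact_mod_cast Finset.mem_range.1 hi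
          have : ((i : ℝ) + 1) * (2 * R) ≤ k * (2 * R) := by gcongr
          have : 0 ≤ (i : ℝ) * (2 * R) := by positivity
          constructor <;> linarith
  have hev := (Metric.tendstoUniformly_iff.1 hν) (1 / (2 * R)) (by positivity)
  obtain ⟨M₀, hM₀⟩ := eventually_atTop.1 hev
  obtain ⟨k, hk⟩ := exists_nat_ge (max M₀ 1 / (2 * R))
  rw [div_le_iff₀ (by positivity)] at hk
  have h1 := hM₀ (k * (2 * R)) ((le_max_left _ _).trans hk) 0
  have hpos : 0 < k * (2 * R) := lt_of_lt_of_le one_pos ((le_max_right _ _).trans hk)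
  have h2 : 1 / (2 * R) ≤ (segCount s p n 0 (k * (2 * R)) : ℝ) / (k * (2 * R)) := by
    rw [div_le_div_iff₀ (by positivity) hpos, one_mul]
    exact mul_le_mul_of_nonneg_right (by exact_mod_cast hcount k) (by positivity)
  rw [Real.dist_eq, abs_lt] at h1
  linarith

/-- In long intervals of equal length, all patterns of a given size occur almost equally often. -/
theorem eventually_segCount_le (hs : IsQuasicrystal s) (p : ℕ) {η : ℝ} (hη : 0 < η) :
    ∀ᶠ M in atTop, ∀ (n : ℤ) (x y : ℝ), 0 < segCount s p n y M ∧
      (segCount s p n x M : ℝ) ≤ (1 + η) * segCount s p n y M := by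
  have hone : ∀ n : ℤ, ∀ᶠ M in atTop, ∀ x y : ℝ, 0 < segCount s p n y M ∧
      (segCount s p n x M : ℝ) ≤ (1 + η) * segCount s p n y M := by
    intro n
    obtain ⟨ν, hν, hlim⟩ := hs.exists_frequency p n
    have hκ : 0 < ν * η / (2 + η) := by positivity
    filter_upwards [(Metric.tendstoUniformly_iff.1 hlim) _ hκ, eventually_gt_atTop 0] with M hM hM0
    intro x y
    have h1 := hM x
    have h2 := hM y
    rw [Real.dist_eq, abs_lt] at h1 h2
    have hlow : ν - ν * η / (2 + η) < segCount s p n y M / M := by linarith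
    have hup : segCount s p n x M / M < ν + ν * η / (2 + η) := by linarith
    rw [lt_div_iff₀ hM0] at hlow
    rw [div_lt_iff₀ hM0] at hup
    have e1 : ν - ν * η / (2 + η) = 2 * ν / (2 + η) := by field_simp; ring
    have e2 : ν + ν * η / (2 + η) = (1 + η) * (2 * ν / (2 + η)) := by field_simp; ring
    rw [e1] at hlow
    rw [e2] at hup
    have hpos : 0 < 2 * ν / (2 + η) * M := by positivity
    refine ⟨by exact_mod_cast hpos.trans hlow, hup.le.trans ?_⟩
    rw [mul_assoc]
    gcongr
  have hfin := hs.finite_range_pattern p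
  have : ∀ t ∈ range (pattern s p), ∀ᶠ M in atTop, ∀ n, pattern s p n = t → ∀ x y : ℝ,
      0 < segCount s p n y M ∧ (segCount s p n x M : ℝ) ≤ (1 + η) * segCount s p n y M := by
    rintro _ ⟨m, rfl⟩
    filter_upwards [hone m] with M hM n hn x y
    have he : ∀ z, segCount s p n z M = segCount s p m z M := by
      intro z
      simp only [segCount, segEquiv_iff_pattern_eq, hn]
    rw [he, he]
    exact hM x y
  filter_upwards [(eventually_all_finite hfin).2 this] with M hM n x y
  exact hM _ (mem_range_self n) n rfl x y

end IsQuasicrystal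

/-! ### Comparison of the densities of a minimal path in two places -/

theorem sum_Icc_int_eq_sum_range (F : ℤ → ℝ) {A C : ℤ} {T : ℕ} (hT : A + T = C + 1) :
    ∑ m ∈ Finset.Icc A C, F m = ∑ t ∈ Finset.range T, F (A + t) := by
  rw [Int.Icc_eq_finset_map, Finset.sum_map, show (C + 1 - A).toNat = T by omega]
  simp

/-- In the sum of the increments of `f` over windows of `K` steps every increment in the bulk is
counted `K` times. -/
theorem sum_window_bounds {f : ℤ → ℝ} (hf : Monotone f) {A C : ℤ} (hAC : A ≤ C + 1) (w K : ℕ) :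
    K * (f C - f (A + (w + K : ℕ))) ≤ ∑ m ∈ Finset.Icc A C, (f (m + (w + K : ℕ)) - f (m + w)) ∧
    ∑ m ∈ Finset.Icc A C, (f (m + (w + K : ℕ)) - f (m + w)) ≤
      K * (f (C + (w + K : ℕ)) - f A) := by
  obtain ⟨T, hT⟩ := Int.eq_ofNat_of_zero_le (show 0 ≤ C + 1 - A by omega)
  have hT' : A + T = C + 1 := by omega
  have e : ∑ m ∈ Finset.Icc A C, (f (m + (w + K : ℕ)) - f (m + w)) =
      ∑ k ∈ Finset.range K, (f (C + 1 + w + k) - f (A + w + k)) := by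
    have h1 : ∀ m : ℤ, f (m + (w + K : ℕ)) - f (m + w) =
        ∑ k ∈ Finset.range K, (f (m + w + (k + 1 : ℕ)) - f (m + w + k)) := by
      intro m
      rw [Finset.sum_range_sub (fun k : ℕ => f (m + w + k))]
      push_cast
      simp [add_assoc]
    simp only [h1]
    rw [Finset.sum_comm]
    refine Finset.sum_congr rfl fun k _ => ?_
    rw [sum_Icc_int_eq_sum_range _ hT']
    have h2 := Finset.sum_range_sub (fun t : ℕ => f (A + t + w + k)) T
    rw [← hT']
    simp only [Nat.cast_zero, add_zero] at h2
    rw [← h2]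
    refine Finset.sum_congr rfl fun t _ => ?_
    congr 2
    push_cast
    ring
  rw [e, ← nsmul_eq_mul, ← nsmul_eq_mul]
  constructor
  · nth_rw 1 [← Finset.card_range K]
    refine Finset.card_nsmul_le_sum _ _ _ fun k hk => ?_
    have := Finset.mem_range.1 hk
    exact sub_le_sub (hf (by omega)) (hf (by push_cast; omega))
  · nth_rw 2 [← Finset.card_range K]
    refine Finset.sum_le_card_nsmul _ _ _ fun k hk => ?_
    have := Finset.mem_range.1 hk
    exact sub_le_sub (hf (by push_cast; omega)) (hf (by omega))

/-- If `g` varies by at most `c` on each fibre of `ty`, and each fibre has almost as many points in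
`Y` as in `X`, then the sum of `g` over `X` is controlled by the sum over `Y`. -/
theorem sum_le_of_fiber {ι κ : Type*} [DecidableEq κ] (X Y : Finset ι) (ty : ι → κ) (g : ι → ℝ)
    (hg : ∀ m, 0 ≤ g m) {c η : ℝ} (h : ∀ n ∈ X, ∀ m ∈ Y, ty n = ty m → g n ≤ g m + c)
    (hpos : ∀ t ∈ X.image ty, 0 < (Y.filter fun m => ty m = t).card)
    (hcard : ∀ t ∈ X.image ty, ((X.filter fun m => ty m = t).card : ℝ) ≤
      (1 + η) * (Y.filter fun m => ty m = t).card) (hη : 0 ≤ η) :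
    ∑ n ∈ X, g n ≤ (1 + η) * ∑ m ∈ Y, g m + c * X.card := by
  have hfib : ∀ t ∈ X.image ty, ∑ n ∈ X with ty n = t, g n ≤
      (1 + η) * ∑ m ∈ Y with ty m = t, g m + c * (X.filter fun m => ty m = t).card := by
    intro t ht
    have hb : (0 : ℝ) < (Y.filter fun m => ty m = t).card := by exact_mod_cast hpos t ht
    have h1 : ∀ n ∈ X.filter (fun m => ty m = t), g n ≤
        (∑ m ∈ Y with ty m = t, g m) / (Y.filter fun m => ty m = t).card + c := by
      intro n hn
      rw [Finset.mem_filter] at hn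
      rw [← sub_le_iff_le_add, le_div_iff₀ hb, mul_comm, ← nsmul_eq_mul]
      refine Finset.card_nsmul_le_sum _ _ _ fun m hm => ?_
      rw [Finset.mem_filter] at hm
      linarith [h n hn.1 m hm.1 (hn.2.trans hm.2.symm)]
    have h2 := Finset.sum_le_card_nsmul _ _ _ h1
    rw [nsmul_eq_mul, mul_add] at h2
    refine h2.trans (add_le_add ?_ (mul_comm _ _).le)
    rw [mul_div_assoc', div_le_iff₀ hb]
    have := mul_le_mul_of_nonneg_right (hcard t ht)
      (Finset.sum_nonneg fun m (_ : m ∈ Y.filter fun m => ty m = t) => hg m)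
    linarith
  have hX : ∑ t ∈ X.image ty, ∑ n ∈ X with ty n = t, g n = ∑ n ∈ X, g n :=
    Finset.sum_fiberwise_of_maps_to (fun n hn => Finset.mem_image_of_mem ty hn) g
  have hc : ∑ t ∈ X.image ty, ((X.filter fun m => ty m = t).card : ℝ) = X.card := by
    rw [Finset.card_eq_sum_card_image ty X]
    push_cast
    rfl
  have hY : ∑ t ∈ X.image ty, ∑ m ∈ Y with ty m = t, g m ≤ ∑ m ∈ Y, g m := by
    rw [Finset.sum_fiberwise_eq_sum_filter]
    exact Finset.sum_le_sum_of_subset_of_nonneg (Finset.filter_subset _ _) fun m _ _ => hg m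
  have hs := Finset.sum_le_sum hfib
  rw [hX, Finset.sum_add_distrib, ← Finset.mul_sum, ← Finset.mul_sum, hc] at hs
  have := mul_le_mul_of_nonneg_left hY (show 0 ≤ 1 + η by linarith)
  linarith

section Density

variable {s : ℤ → ℝ} {U V : ℝ → ℝ} {R : ℝ}

/-- The windows of `K` atoms in `[x, x + M]` are matched with windows of the same type in a disjoint
interval, which is slightly longer in order to absorb the boundary effects. -/
theorem exists_atomCount_compare_of_disjoint (hs : IsQuasicrystal s)
    (hU : StrictConvexOn ℝ univ U) (hUd : Differentiable ℝ U) (hU' : StrictMono (deriv U))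
    (hVd : Differentiable ℝ V) (hVR : HasRange (range s) V R) {η : ℝ} (hη : 0 < η) (hη1 : η ≤ 1) :
    ∃ M₀ : ℝ, 0 < M₀ ∧ ∀ M, M₀ ≤ M → ∀ (n : ℕ) (a b : ℝ) (θ : ℕ → ℝ), IsMinPath U V n a b θ →
      ∀ x y, a < y → y + 2 * M ≤ b → (x + 3 * M ≤ y ∨ y + 3 * M ≤ x) →
        (atomCount θ n (x + M) : ℝ) - atomCount θ n x ≤
          (1 + η) * (atomCount θ n (y + (1 + η) * M) - atomCount θ n y) + η * M := by
  obtain ⟨δ, hδ, hgap⟩ := hs.exists_gap_ge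
  obtain ⟨G, hG, hgap'⟩ := hs.exists_gap_le
  obtain ⟨w, hw⟩ := hs.exists_potential_eq hVR
  -- With windows of `K` atoms, a discrepancy of two for each window is negligible.
  obtain ⟨K, hK⟩ := exists_nat_ge (6 / (δ * η))
  have hKpos : (0 : ℝ) < K := lt_of_lt_of_le (by positivity) hK
  obtain ⟨p, hp⟩ : ∃ p, p = w + K + w := ⟨_, rfl⟩
  obtain ⟨M₁, hM₁⟩ := eventually_atTop.1 (hs.eventually_segCount_le p hη)
  obtain ⟨D, hD⟩ : ∃ D, D = (p + 1 : ℕ) * G := ⟨_, rfl⟩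
  refine ⟨max M₁ (max δ (2 * D / η)), lt_max_of_lt_right (lt_max_of_lt_left hδ), ?_⟩
  intro M hM n a b θ h x y hay hyb hxy
  have hMδ : δ ≤ M := (le_max_left _ _).trans ((le_max_right _ _).trans hM)
  have hMD : 2 * D ≤ η * M := by
    have : 2 * D / η ≤ M := (le_max_right _ _).trans ((le_max_right _ _).trans hM)
    rwa [div_le_iff₀ hη, mul_comm M] at this
  have hM0 : 0 < M := hδ.trans_le hMδ
  have hηM : η * M ≤ M := mul_le_of_le_one_left hM0.le hη1
  have hηM0 : 0 < η * M := by positivity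
  obtain ⟨M', hM'⟩ : ∃ M', M' = (1 + η) * M := ⟨_, rfl⟩
  rw [← hM']
  have hM'e : M' = M + η * M := by rw [hM']; ring
  have hfreq := hM₁ M' (((le_max_left _ _).trans hM).trans (by linarith))
  obtain ⟨z, hz⟩ : ∃ z, z = x - η * M / 2 := ⟨_, rfl⟩
  obtain ⟨A, B, hA, hB, hAB⟩ := hs.exists_window p z M'
  obtain ⟨A', B', hA', hB', hAB'⟩ := hs.exists_window p y M'
  have hne : ∀ {A B : ℤ} {z : ℝ}, (∀ m, (∀ i : ℕ, i ≤ p → s (m + i) ∈ Icc z (z + M')) ↔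
      m ∈ Finset.Icc A (B - p)) → A ≤ B - p := by
    intro A B z hAB
    classical
    have := (hfreq 0 z z).1
    rw [segCount_eq_card hAB] at this
    obtain ⟨m, hm⟩ := Finset.card_pos.1 this
    have := Finset.mem_Icc.1 (Finset.mem_filter.1 hm).1
    omega
  have hne1 := hne hAB
  have hne2 := hne hAB'
  have hmonoN : Monotone fun z => (atomCount θ n z : ℝ) :=
    fun _ _ h => Nat.cast_le.2 (atomCount_mono θ n h)
  have hf : Monotone fun m : ℤ => (atomCount θ n (s m) : ℝ) := hmonoN.comp hs.strictMono.monotone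
  have low := (sum_window_bounds hf (show A ≤ B - p + 1 by omega) w K).1
  have upp := (sum_window_bounds hf (show A' ≤ B' - p + 1 by omega) w K).2
  have hx1 : x + M ≤ s (B - p) := by
    have h1 := sub_le_mul_of_gap_le hgap' (B - p) (p + 1)
    have h2 : ¬ s (B + 1) ≤ z + M' := by rw [hB]; omega
    rw [show B - p + ((p + 1 : ℕ) : ℤ) = B + 1 by push_cast; ring, ← hD] at h1
    linarith
  have hx0 : s (A + (w + K : ℕ)) ≤ x := by
    have h1 := sub_le_mul_of_gap_le hgap' (A - 1) (w + K + 1)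
    have h2 : ¬ z ≤ s (A - 1) := by rw [hA]; omega
    rw [show A - 1 + ((w + K + 1 : ℕ) : ℤ) = A + (w + K : ℕ) by push_cast; ring] at h1
    have h3 : ((w + K + 1 : ℕ) : ℝ) * G ≤ D := by
      rw [hD]
      exact mul_le_mul_of_nonneg_right (by exact_mod_cast (by omega)) hG.le
    linarith
  have hy1 : s (B' - p + (w + K : ℕ)) ≤ y + M' := (hB' _).2 (by rw [hp]; push_cast; omega)
  have hy0 : y ≤ s A' := (hA' _).2 le_rfl
  have hcard : ((Finset.Icc A (B - p)).card : ℝ) ≤ 3 * M / δ := by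
    obtain ⟨T, hT⟩ := Int.eq_ofNat_of_zero_le (show 0 ≤ B - p - A by omega)
    have h1 := mul_le_sub_of_gap_ge hgap A T
    have h2 := (hA A).2 le_rfl
    have h3 : s (A + T) ≤ z + M' := (hB _).2 (by omega)
    rw [Int.card_Icc, show (B - p + 1 - A).toNat = T + 1 by omega, le_div_iff₀ hδ]
    push_cast
    linarith
  have hfib : ∀ k ∈ Finset.Icc A (B - p), ∀ m ∈ Finset.Icc A' (B' - p),
      pattern s p k = pattern s p m →
      (atomCount θ n (s (k + (w + K : ℕ))) : ℝ) - atomCount θ n (s (k + w)) ≤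
        (atomCount θ n (s (m + (w + K : ℕ))) : ℝ) - atomCount θ n (s (m + w)) + 2 := by
    intro k hk m hm hkm
    have hk' := (hAB k).2 hk
    have hm' := (hAB' m).2 hm
    have hseg : SegEquiv s (w + K + w) m k := hp ▸ segEquiv_iff_pattern_eq.2 hkm.symm
    have e1 := hseg.eq_add (show w ≤ w + K + w by omega)
    have e2 := hseg.eq_add (show w + K ≤ w + K + w by omega)
    have b1 := hk' w (by omega)
    have b2 := hk' (w + K) (by omega)
    have b3 := hm' w (by omega)
    have b4 := hm' (w + K) (by omega)
    have := h.atomCount_translate_le hU hUd hU' hVd (x₀ := s (m + w)) (x₁ := s (m + (w + K : ℕ)))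
      (τ := s k - s m) (hay.trans_le b3.1)
      (hs.strictMono.monotone (by push_cast; omega)) (b4.2.trans (by linarith))
      (fun x hx => hw K m k hseg x (Ico_subset_Icc_self hx))
      (by
        rw [← e1, ← e2]
        rcases hxy with hxy | hxy
        · right; linarith [b2.2, b3.1]
        · left; linarith [b1.1, b4.2])
    rw [← e1, ← e2] at this
    have : (atomCount θ n (s (k + (w + K : ℕ))) : ℝ) + atomCount θ n (s (m + w)) ≤
      atomCount θ n (s (k + w)) + atomCount θ n (s (m + (w + K : ℕ))) + 2 := by
      exact_mod_cast this
    linarith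
  classical
  have hsum := sum_le_of_fiber (Finset.Icc A (B - p)) (Finset.Icc A' (B' - p)) (pattern s p)
    (fun m => (atomCount θ n (s (m + (w + K : ℕ))) : ℝ) - atomCount θ n (s (m + w)))
    (fun m => sub_nonneg.2 (hf (by push_cast; omega))) hfib
    (fun t ht => by
      obtain ⟨m, -, rfl⟩ := Finset.mem_image.1 ht
      rw [← segCount_eq_card hAB']
      exact (hfreq m y y).1)
    (fun t ht => by
      obtain ⟨m, -, rfl⟩ := Finset.mem_image.1 ht
      rw [← segCount_eq_card hAB', ← segCount_eq_card hAB]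
      exact (hfreq m z y).2) hη.le
  have i1 := hmonoN hx1
  have i2 := hmonoN hx0
  have i3 := hmonoN hy1
  have i4 := hmonoN hy0
  simp only at i1 i2 i3 i4 low upp hsum
  have hK' : 6 * M / δ ≤ K * (η * M) := by
    rw [div_le_iff₀ (by positivity)] at hK ⊢
    nlinarith
  have q1 : K * ((atomCount θ n (x + M) : ℝ) - atomCount θ n x) ≤
      K * ((1 + η) * (atomCount θ n (y + M') - atomCount θ n y) + η * M) := by
    have c1 := mul_le_mul_of_nonneg_left (sub_le_sub i1 i2) hKpos.le
    have c2 := mul_le_mul_of_nonneg_left (sub_le_sub i3 i4) hKpos.le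
    have c3 := mul_le_mul_of_nonneg_left (upp.trans c2) (show 0 ≤ 1 + η by linarith)
    have e : 3 * M / δ * 2 = 6 * M / δ := by ring
    calc _ ≤ _ := c1.trans low
      _ ≤ _ := hsum
      _ ≤ (1 + η) * (K * (atomCount θ n (y + M') - atomCount θ n y)) + 6 * M / δ := by linarith
      _ ≤ _ := by rw [mul_add]; linarith
  exact le_of_mul_le_mul_left q1 hKpos

/-- A third interval, disjoint from both, allows the comparison of any two intervals. -/
theorem exists_atomCount_compare (hs : IsQuasicrystal s)
    (hU : StrictConvexOn ℝ univ U) (hUd : Differentiable ℝ U) (hU' : StrictMono (deriv U))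
    (hVd : Differentiable ℝ V) (hVR : HasRange (range s) V R) {κ : ℝ} (hκ : 0 < κ) (hκ1 : κ ≤ 1) :
    ∃ M₀ : ℝ, 0 < M₀ ∧ ∀ M, M₀ ≤ M → ∀ (n : ℕ) (a b : ℝ) (θ : ℕ → ℝ), IsMinPath U V n a b θ →
      30 * M ≤ b - a → ∀ x y, a < y → y + 4 * M ≤ b →
        (atomCount θ n (x + M) : ℝ) - atomCount θ n x ≤
          (1 + κ) * (atomCount θ n (y + (1 + κ) * M) - atomCount θ n y) + κ * M := by
  obtain ⟨η, hη⟩ : ∃ η, η = κ / 5 := ⟨_, rfl⟩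
  have hη0 : 0 < η := by rw [hη]; positivity
  have hη1 : η ≤ 1 / 5 := by rw [hη]; linarith
  obtain ⟨M₀, hM₀, H⟩ := exists_atomCount_compare_of_disjoint hs hU hUd hU' hVd hVR hη0
    (by linarith)
  refine ⟨M₀, hM₀, fun M hM n a b θ h hab x y hay hyb => ?_⟩
  have hMpos : 0 < M := hM₀.trans_le hM
  have hηκ : (1 + η) * (1 + η) ≤ 1 + κ := by
    rw [show κ = 5 * η by linarith]; nlinarith only [hη0, hη1]
  obtain ⟨M', hM'⟩ : ∃ M', M' = (1 + η) * M := ⟨_, rfl⟩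
  have hM'1 : M ≤ M' := by rw [hM']; nlinarith
  have hM'2 : M' ≤ 2 * M := by rw [hM']; nlinarith
  obtain ⟨z, hza, hzb, hzx, hzy⟩ : ∃ z, a < z ∧ z + 2 * M ≤ b ∧
      (x + 3 * M ≤ z ∨ z + 3 * M ≤ x) ∧ (z + 6 * M ≤ y ∨ y + 6 * M ≤ z) := by
    by_contra! hcon
    have c1 := hcon (a + M) (by linarith) (by linarith)
    have c2 := hcon (a + M + 13 * M) (by linarith) (by linarith)
    have c3 := hcon (a + M + 26 * M) (by linarith) (by linarith)
    by_cases h1 : x + 3 * M ≤ a + M ∨ a + M + 3 * M ≤ x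
    · have d1 := c1 h1
      by_cases h2 : x + 3 * M ≤ a + M + 13 * M ∨ a + M + 13 * M + 3 * M ≤ x
      · have d2 := c2 h2
        linarith
      · simp only [not_or, not_le] at h2
        have d3 := c3 (by left; linarith)
        linarith
    · simp only [not_or, not_le] at h1
      have d2 := c2 (by left; linarith)
      have d3 := c3 (by left; linarith)
      linarith
  have h1 := H M hM n a b θ h x z hza hzb hzx
  have h2 := H M' (hM.trans hM'1) n a b θ h z y hay (by linarith)
    (by rcases hzy with hzy | hzy <;> [left; right] <;> linarith)
  rw [← hM'] at h1
  have hmono : (atomCount θ n (y + (1 + η) * M') : ℝ) ≤ atomCount θ n (y + (1 + κ) * M) := by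
    refine Nat.cast_le.2 (atomCount_mono θ n ?_)
    rw [hM', ← mul_assoc]
    gcongr
  have hnn : (0 : ℝ) ≤ atomCount θ n (y + (1 + κ) * M) - atomCount θ n y :=
    sub_nonneg.2 (Nat.cast_le.2 (atomCount_mono θ n (by nlinarith)))
  have h3 := mul_le_mul_of_nonneg_left h2 (show 0 ≤ 1 + η by linarith)
  have h4 := mul_le_mul_of_nonneg_left (sub_le_sub_right hmono (atomCount θ n y : ℝ))
    (show 0 ≤ (1 + η) * (1 + η) by positivity)
  have h5 := mul_le_mul_of_nonneg_right hηκ hnn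
  have h6 : (1 + η) * (η * M') + η * M ≤ κ * M := by
    have e : (1 + η) * (η * M') + η * M = (η * ((1 + η) * (1 + η)) + η) * M := by rw [hM']; ring
    rw [e]
    have : η * ((1 + η) * (1 + η)) ≤ η * 4 :=
      mul_le_mul_of_nonneg_left (by linarith) hη0.le
    gcongr
    linarith
  linarith

/-- Upper bound for the density: compare `[y, y + M)` with consecutive intervals which fill most of
`[a, b]`, and sum. -/
theorem atomCount_le_of_compare {n : ℕ} {a b : ℝ} {θ : ℕ → ℝ} {ρ κ η M : ℝ} (hρ : 0 < ρ)
    (hκ0 : 0 < κ) (hκ1 : κ ≤ 1) (hκη : κ * (7 / ρ + 1) ≤ η) (hM0 : 0 < M)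
    (hab : b - a = n * ρ) (hnρ : 30 * M ≤ n * ρ)
    (hnρ2 : (8 * M + ρ) * (1 + κ) ≤ κ * (n * ρ))
    (H : ∀ x y, a < y → y + 4 * M ≤ b → (atomCount θ n (x + M) : ℝ) - atomCount θ n x ≤
      (1 + κ) * (atomCount θ n (y + (1 + κ) * M) - atomCount θ n y) + κ * M) (y : ℝ) :
    (atomCount θ n (y + M) : ℝ) - atomCount θ n y ≤ M / ρ + η * M := by
  obtain ⟨c, hc⟩ : ∃ c, c = (atomCount θ n (y + M) : ℝ) - atomCount θ n y := ⟨_, rfl⟩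
  obtain ⟨M', hM'⟩ : ∃ M', M' = (1 + κ) * M := ⟨_, rfl⟩
  have hM'1 : M ≤ M' := by rw [hM']; nlinarith
  have hM'2 : M' ≤ 2 * M := by rw [hM']; nlinarith
  obtain ⟨k, hk⟩ : ∃ k, k = ⌊(n * ρ - 6 * M) / M'⌋₊ := ⟨_, rfl⟩
  have hk1 : k * M' ≤ n * ρ - 6 * M := by
    rw [← le_div_iff₀ (by linarith), hk]
    exact Nat.floor_le (div_nonneg (by linarith) (by linarith))
  have hk2 : n * ρ - 8 * M ≤ k * M' := by
    have := Nat.lt_floor_add_one ((n * ρ - 6 * M) / M')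
    rw [← hk, div_lt_iff₀ (by linarith)] at this
    linarith
  -- Compare with each of `k` consecutive intervals filling most of `[a, b]`.
  have hsum : ∀ i ∈ Finset.range k, c ≤ (1 + κ) *
      (atomCount θ n (a + M + (i + 1 : ℕ) * M') - atomCount θ n (a + M + i * M')) + κ * M := by
    intro i hi
    have hik : ((i : ℝ) + 1) ≤ k := by exact_mod_cast Finset.mem_range.1 hi
    have h1 : ((i : ℝ) + 1) * M' ≤ k * M' := mul_le_mul_of_nonneg_right hik (by linarith)
    have h2 : 0 ≤ (i : ℝ) * M' := mul_nonneg (Nat.cast_nonneg i) (by linarith)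
    have := H y (a + M + i * M') (by linarith)
      (by linarith)
    rw [← hM', ← hc] at this
    convert this using 6
    push_cast
    ring
  have hs1 := Finset.card_nsmul_le_sum _ _ _ hsum
  rw [Finset.sum_add_distrib, ← Finset.mul_sum,
    Finset.sum_range_sub (fun i : ℕ => (atomCount θ n (a + M + i * M') : ℝ)),
    Finset.sum_const, Finset.card_range, nsmul_eq_mul, nsmul_eq_mul] at hs1
  have hN1 : (atomCount θ n (a + M + k * M') : ℝ) ≤ n + 1 := by
    exact_mod_cast atomCount_le θ n _
  have hN0 : (0 : ℝ) ≤ atomCount θ n (a + M + (0 : ℕ) * M') := Nat.cast_nonneg _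
  have hs2 : k * (c - κ * M) ≤ (1 + κ) * (n + 1) := by
    have := mul_le_mul_of_nonneg_left (show (atomCount θ n (a + M + k * M') : ℝ) -
      atomCount θ n (a + M + (0 : ℕ) * M') ≤ n + 1 by linarith) (show 0 ≤ 1 + κ by linarith)
    linarith
  have hkpos : 0 < (k : ℝ) := by
    have : 0 < k * M' := by linarith
    exact pos_of_mul_pos_left this (by linarith)
  -- The average number of atoms in these intervals.
  have hn1 : (n + 1) * ρ ≤ (1 + κ) * (k * M') := by
    have := mul_le_mul_of_nonneg_left hk2 (show 0 ≤ 1 + κ by linarith)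
    have h2 : 0 < κ * ρ := by positivity
    linarith
  have hs3 : k * ((c - κ * M) * ρ) ≤ k * ((1 + κ) * ((1 + κ) * M')) := by
    have h1 := mul_le_mul_of_nonneg_right hs2 hρ.le
    have h2 := mul_le_mul_of_nonneg_left hn1 (show 0 ≤ 1 + κ by linarith)
    linarith
  have hs4 := le_of_mul_le_mul_left hs3 hkpos
  have hcube : (1 + κ) * ((1 + κ) * M') ≤ (1 + 7 * κ) * M := by
    have h1 : κ * κ ≤ κ := mul_le_of_le_one_left hκ0.le hκ1
    have h2 : κ * (κ * κ) ≤ κ := (mul_le_of_le_one_left (by positivity) hκ1).trans h1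
    have : (1 + κ) * ((1 + κ) * (1 + κ)) ≤ 1 + 7 * κ := by linarith
    calc _ = (1 + κ) * ((1 + κ) * (1 + κ)) * M := by rw [hM']; ring
      _ ≤ _ := by gcongr
  have hs5 : c - κ * M ≤ (1 + 7 * κ) * M / ρ := (le_div_iff₀ hρ).2 (hs4.trans hcube)
  have e : (1 + 7 * κ) * M / ρ + κ * M = M / ρ + κ * (7 / ρ + 1) * M := by field_simp; ring
  have := mul_le_mul_of_nonneg_right hκη hM0.le
  rw [← hc]
  linarith

/-- Lower bound for the density: compare with consecutive intervals which cover `[a, b]`, and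
sum. -/
theorem le_atomCount_of_compare {n : ℕ} {a b : ℝ} {θ : ℕ → ℝ} {ρ κ η m M : ℝ} (hρ : 0 < ρ)
    (hκ0 : 0 < κ) (hκ1 : κ ≤ 1) (hκη : κ * (7 / ρ + 1) ≤ η) (hη : 0 < η) (hm0 : 0 < m)
    (hmM : M = (1 + κ) * m) (hab : b - a = n * ρ) (hnρ : m ≤ κ * (n * ρ))
    (hθ : ∀ j ≤ n, θ j ∈ Icc a b) {y : ℝ}
    (H : ∀ x, (atomCount θ n (x + m) : ℝ) - atomCount θ n x ≤
      (1 + κ) * (atomCount θ n (y + (1 + κ) * m) - atomCount θ n y) + κ * m) :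
    M / ρ - η * M ≤ (atomCount θ n (y + M) : ℝ) - atomCount θ n y := by
  have hM0 : 0 < M := by rw [hmM]; positivity
  obtain ⟨c, hc⟩ : ∃ c, c = (atomCount θ n (y + M) : ℝ) - atomCount θ n y := ⟨_, rfl⟩
  have hc0 : 0 ≤ c := by
    rw [hc]; exact sub_nonneg.2 (Nat.cast_le.2 (atomCount_mono θ n (by linarith)))
  obtain ⟨k, hk⟩ : ∃ k, k = ⌊(n * ρ) / m⌋₊ + 1 := ⟨_, rfl⟩
  have hk1 : n * ρ < k * m := by
    rw [← div_lt_iff₀ hm0, hk]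
    exact_mod_cast Nat.lt_floor_add_one _
  have hk2 : k * m ≤ n * ρ + m := by
    have := Nat.floor_le (show 0 ≤ n * ρ / m by positivity)
    rw [le_div_iff₀ hm0] at this
    rw [hk]
    push_cast
    linarith
  have hsum : ∀ i ∈ Finset.range k, ((atomCount θ n (a + (i + 1 : ℕ) * m) : ℝ) -
      atomCount θ n (a + i * m)) ≤ (1 + κ) * c + κ * m := by
    intro i _
    have := H (a + i * m)
    rw [← hmM, ← hc] at this
    convert this using 4
    push_cast
    ring
  have hs1 := Finset.sum_le_card_nsmul _ _ _ hsum
  rw [Finset.sum_range_sub (fun i : ℕ => (atomCount θ n (a + i * m) : ℝ)),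
    Finset.card_range, nsmul_eq_mul] at hs1
  have hN0 : atomCount θ n (a + (0 : ℕ) * m) = 0 := by
    unfold atomCount
    rw [Finset.card_eq_zero, Finset.filter_eq_empty_iff]
    intro j hj
    simpa using (hθ j (Nat.lt_succ_iff.1 (Finset.mem_range.1 hj))).1
  have hN1 : atomCount θ n (a + k * m) = n + 1 := by
    unfold atomCount
    rw [Finset.filter_true_of_mem, Finset.card_range]
    intro j hj
    have := (hθ j (Nat.lt_succ_iff.1 (Finset.mem_range.1 hj))).2
    linarith
  rw [hN0, hN1] at hs1
  push_cast at hs1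
  have hkpos : 0 < (k : ℝ) := by
    have h1 : 0 ≤ n * ρ := by positivity
    have : 0 < k * m := by linarith
    exact pos_of_mul_pos_left this hm0.le
  have hn1 : (1 - κ) * (k * m) ≤ n * ρ := by
    have := mul_le_mul_of_nonneg_left hk2 (show 0 ≤ 1 - κ by linarith)
    have h2 : (1 - κ) * m ≤ m := by nlinarith only [hm0, hκ0]
    linarith
  have hs3 : k * ((1 - κ) * m) ≤ k * (((1 + κ) * c + κ * m) * ρ) := by
    have h1 := mul_le_mul_of_nonneg_right hs1 hρ.le
    have h2 : (n : ℝ) * ρ ≤ (n + 1 - 0) * ρ := by gcongr; linarith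
    linarith
  have hs4 := le_of_mul_le_mul_left hs3 hkpos
  have hs5 : (1 - κ) * m / ρ ≤ (1 + κ) * c + κ * m := (div_le_iff₀ hρ).2 hs4
  -- Multiply by `1 + κ` to compare with the interval of length `M`.
  have hs6 : (1 - κ) * M / ρ - κ * M ≤ (1 + 3 * κ) * c := by
    have h1 := mul_le_mul_of_nonneg_left hs5 (show 0 ≤ 1 + κ by linarith)
    have e : (1 + κ) * ((1 - κ) * m / ρ) = (1 - κ) * M / ρ := by rw [hmM]; ring
    rw [e] at h1
    have h2 : (1 + κ) * (1 + κ) * c ≤ (1 + 3 * κ) * c :=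
      mul_le_mul_of_nonneg_right (by nlinarith only [hκ0, hκ1]) hc0
    have h3 : (1 + κ) * (κ * m) = κ * M := by rw [hmM]; ring
    linarith
  rw [← hc]
  by_contra! hlt
  have h1 := mul_lt_mul_of_pos_left hlt (show 0 < 1 + 3 * κ by linarith)
  have h2 := mul_le_mul_of_nonneg_right hκη hM0.le
  have e1 : (1 - κ) * M / ρ = M / ρ - κ * (M / ρ) := by ring
  have e2 : κ * (7 / ρ + 1) * M = 7 * κ * (M / ρ) + κ * M := by ring
  have h3 : 0 < κ * (M / ρ) := by positivity
  have h4 : 0 < κ * (η * M) := by positivity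
  rw [e1] at hs6
  rw [e2] at h2
  linarith

/-- Away from the ends of its box, a long minimal path with mean spacing `ρ` has density `1 / ρ` in
all intervals of length `M`, up to an error which is small when `M` is large. -/
theorem exists_atomCount_density (hs : IsQuasicrystal s)
    (hU : StrictConvexOn ℝ univ U) (hUd : Differentiable ℝ U) (hU' : StrictMono (deriv U))
    (hVd : Differentiable ℝ V) (hVR : HasRange (range s) V R) {ρ : ℝ} (hρ : 0 < ρ) {η : ℝ}
    (hη : 0 < η) :
    ∃ M₀ : ℝ, 0 < M₀ ∧ ∀ M, M₀ ≤ M → ∃ n₀ : ℕ, ∀ n, n₀ ≤ n → ∀ (a b : ℝ) (θ : ℕ → ℝ),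
      IsMinPath U V n a b θ → b - a = n * ρ → ∀ y, a < y → y + 4 * M ≤ b →
        |(atomCount θ n (y + M) : ℝ) - atomCount θ n y - M / ρ| ≤ η * M := by
  obtain ⟨κ, hκ⟩ : ∃ κ, κ = min 1 (η / (7 / ρ + 1)) := ⟨_, rfl⟩
  have hκ0 : 0 < κ := by rw [hκ]; exact lt_min one_pos (by positivity)
  have hκ1 : κ ≤ 1 := hκ ▸ min_le_left _ _
  have hκη : κ * (7 / ρ + 1) ≤ η := by
    rw [← le_div_iff₀ (by positivity)]; exact hκ ▸ min_le_right _ _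
  obtain ⟨M₀, hM₀, H⟩ := exists_atomCount_compare hs hU hUd hU' hVd hVR hκ0 hκ1
  refine ⟨2 * M₀, by positivity, fun M hM => ?_⟩
  have hM0 : 0 < M := by linarith
  obtain ⟨n₀, hn₀⟩ := exists_nat_ge ((30 * M + (8 * M + ρ) * (1 + κ) / κ) / ρ)
  refine ⟨n₀, fun n hn a b θ h hab y hay hyb => ?_⟩
  have hnρ : 30 * M + (8 * M + ρ) * (1 + κ) / κ ≤ n * ρ := by
    rw [div_le_iff₀ hρ] at hn₀
    exact hn₀.trans (by gcongr)
  have hq0 : 0 ≤ (8 * M + ρ) * (1 + κ) / κ := by positivity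
  have hnρ2 : (8 * M + ρ) * (1 + κ) ≤ κ * (n * ρ) := by
    rw [mul_comm κ, ← div_le_iff₀ hκ0]; linarith
  have hmM : M = (1 + κ) * (M / (1 + κ)) := by field_simp
  have hm0 : 0 < M / (1 + κ) := by positivity
  have hmM₀ : M₀ ≤ M / (1 + κ) := by rw [le_div_iff₀ (by linarith)]; nlinarith
  have hmM1 : M / (1 + κ) ≤ M := div_le_self hM0.le (by linarith)
  have hup := atomCount_le_of_compare (θ := θ) hρ hκ0 hκ1 hκη hM0 hab (by linarith) hnρ2
    (fun x y => H M (by linarith) n a b θ h (by linarith) x y) y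
  have hM8 : M ≤ (8 * M + ρ) * (1 + κ) := by nlinarith
  have hlow := le_atomCount_of_compare hρ hκ0 hκ1 hκη hη hm0 hmM hab (by linarith) h.mem
    (fun x => H _ hmM₀ n a b θ h (by linarith) x y hay (by linarith))
  rw [abs_le]
  constructor <;> linarith

end Density

/-! ### Limits of minimal paths -/

theorem IsMinPath.pathEnergy_le {U V : ℝ → ℝ} {n : ℕ} {a b : ℝ} {θ : ℕ → ℝ}
    (h : IsMinPath U V n a b θ) {k q : ℕ} (hkq : k + q ≤ n) (φ : ℕ → ℝ) (h0 : φ 0 = θ k)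
    (hq : φ q = θ (k + q)) (hB : ∀ t ≤ q, φ t ∈ Icc a b) :
    pathEnergy U V θ k (k + q) ≤ pathEnergy U V φ 0 q := by
  have hr : Reach U V (Icc a b) q (θ k) (θ (k + q)) (pathEnergy U V φ 0 q) :=
    ⟨φ, h0, hq, hB, rfl⟩
  have := h.le _ ((((h.reach_start (by omega)).trans hr).trans (h.reach_end hkq)).congr
    (by omega) rfl)
  have e1 := pathEnergy_consecutive U V θ (Nat.zero_le k) (Nat.le_add_right k q)
  have e2 := pathEnergy_consecutive U V θ (Nat.zero_le (k + q)) hkq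
  linarith

theorem segEnergy_eq_pathEnergy {U V : ℝ → ℝ} {ψ : ℤ → ℝ} {θ : ℕ → ℝ} {i : ℤ} {k q : ℕ}
    (h : ∀ t ≤ q, ψ (i + t) = θ (k + t)) : segEnergy U V ψ i q = pathEnergy U V θ k (k + q) := by
  unfold segEnergy pathEnergy bondEnergy
  rw [Finset.sum_Ico_eq_sum_range, Nat.add_sub_cancel_left]
  refine Finset.sum_congr rfl fun t ht => ?_
  have ht' := Finset.mem_range.1 ht
  have := h (t + 1) ht'
  push_cast at this
  rw [add_assoc i, this, h t ht'.le, add_assoc k]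

/-- Minimal paths in larger and larger boxes, indexed from `p L`, have a limit point, which is a
minimal configuration, as soon as each atom stays in a bounded region. -/
theorem exists_isMinimalConfiguration_of_isMinPath {U V : ℝ → ℝ} (hU : StrictConvexOn ℝ univ U)
    (hUc : Continuous U) (hVc : Continuous V) {n p : ℕ → ℕ} {a b : ℕ → ℝ} {Θ : ℕ → ℕ → ℝ}
    (h : ∀ L, IsMinPath U V (n L) (a L) (b L) (Θ L)) (ha : Tendsto a atTop atBot)
    (hb : Tendsto b atTop atTop)
    (hbd : ∀ i : ℤ, ∃ C : ℝ, ∀ᶠ L in atTop,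
      0 ≤ p L + i ∧ p L + i ≤ n L ∧ Θ L (p L + i).toNat ∈ Icc (-C) C) :
    ∃ θ : ℤ → ℝ, IsMinimalConfiguration U V θ ∧ ∀ (i : ℤ) (X : Set ℝ), IsClosed X →
      (∀ᶠ L in atTop, Θ L (p L + i).toNat ∈ X) → θ i ∈ X := by
  let F : Filter ℕ := (hyperfilter ℕ : Ultrafilter ℕ)
  have hF : F ≤ atTop := Nat.hyperfilter_le_atTop
  have : F.NeBot := (hyperfilter ℕ).neBot
  have hlim : ∀ i : ℤ, ∃ x, Tendsto (fun L => Θ L (p L + i).toNat) F (𝓝 x) := by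
    intro i
    obtain ⟨C, hC⟩ := hbd i
    have hmem : Icc (-C) C ∈ (hyperfilter ℕ).map fun L => Θ L (p L + i).toNat := by
      rw [Ultrafilter.mem_map]
      exact hF (hC.mono fun L hL => hL.2.2)
    obtain ⟨x, -, hx⟩ := isCompact_Icc.ultrafilter_le_nhds _ (le_principal_iff.2 hmem)
    exact ⟨x, hx⟩
  choose θ hθ using hlim
  refine ⟨θ, ⟨?_, ?_⟩, fun i X hX hev => hX.mem_of_tendsto (hθ i) (hF hev)⟩
  · intro i j hij
    obtain ⟨C, hC⟩ := hbd i
    obtain ⟨C', hC'⟩ := hbd j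
    refine le_of_tendsto_of_tendsto (hθ i) (hθ j) (hF ?_)
    filter_upwards [hC, hC'] with L h1 h2
    exact (h L).monotone hU _ _ (by omega) (by omega)
  · intro i q φ hφ0 hφq
    rcases Nat.eq_zero_or_pos q with rfl | hq
    · simp [segEnergy]
    -- Correct the ends of the competitor to those of the approximating paths.
    let χ : ℕ → ℤ → ℝ := fun L j => if j = i then Θ L (p L + i).toNat else
      if j = i + q then Θ L (p L + (i + q)).toNat else φ j
    have hχ : ∀ j, Tendsto (fun L => χ L j) F (𝓝 (φ j)) := by
      intro j
      by_cases h1 : j = i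
      · subst h1
        simpa [χ, hφ0] using hθ j
      · by_cases h2 : j = i + q
        · subst h2
          have hne : q ≠ 0 := hq.ne'
          simpa [χ, hφq, hne] using hθ (i + q)
        · simp only [χ, if_neg h1, if_neg h2]
          exact tendsto_const_nhds
    have hE : ∀ (ξ : ℕ → ℤ → ℝ) (ξ' : ℤ → ℝ), (∀ j, Tendsto (fun L => ξ L j) F (𝓝 (ξ' j))) →
        Tendsto (fun L => segEnergy U V (ξ L) i q) F (𝓝 (segEnergy U V ξ' i q)) := by
      intro ξ ξ' hξ
      refine tendsto_finsetSum _ fun t _ => Tendsto.add ?_ ?_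
      · exact (hUc.tendsto _).comp ((hξ _).sub (hξ _))
      · exact (hVc.tendsto _).comp (hξ _)
    refine le_of_tendsto_of_tendsto (hE (fun L j => Θ L (p L + j).toNat) θ hθ) (hE χ φ hχ) (hF ?_)
    obtain ⟨C, hC⟩ := hbd i
    obtain ⟨C', hC'⟩ := hbd (i + q)
    have hbox : ∀ᶠ L in atTop, ∀ t ∈ Finset.range (q + 1), φ (i + t) ∈ Icc (a L) (b L) := by
      rw [Filter.eventually_all_finset]
      intro t _
      filter_upwards [ha.eventually_le_atBot (φ (i + t)), hb.eventually_ge_atTop (φ (i + t))]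
        with L h1 h2 using ⟨h1, h2⟩
    filter_upwards [hC, hC', hbox] with L h1 h2 h3
    obtain ⟨k, hk⟩ := Int.eq_ofNat_of_zero_le h1.1
    have hkq : k + q ≤ n L := by omega
    have hto : ∀ t : ℕ, (p L + (i + t)).toNat = k + t := by intro t; omega
    have hto0 : (p L + i).toNat = k := by omega
    rw [segEnergy_eq_pathEnergy (θ := Θ L) (k := k) (fun t _ => by simp only [hto]),
      segEnergy_eq_pathEnergy (θ := fun t => χ L (i + t)) (k := 0) (fun t _ => by simp), zero_add]
    refine (h L).pathEnergy_le hkq _ ?_ ?_ ?_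
    · simp [χ, hto0]
    · have hne : q ≠ 0 := hq.ne'
      simp [χ, hne, hto]
    · intro t ht
      by_cases c1 : (i + t : ℤ) = i
      · simp only [χ, if_pos c1, hto0]
        exact (h L).mem k (by omega)
      · by_cases c2 : (i + t : ℤ) = i + q
        · simp only [χ, if_neg c1, if_pos c2, hto]
          exact (h L).mem _ hkq
        · simp only [χ, if_neg c1, if_neg c2]
          exact h3 t (Finset.mem_range.2 (by omega))

theorem hasRotationNumber_of_forall {θ : ℤ → ℝ} {ρ : ℝ}
    (h : ∀ ε, 0 < ε → ∃ J : ℕ, ∀ j : ℕ, J ≤ j →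
      |θ j - j * ρ| ≤ j * ε ∧ |θ (-j) + j * ρ| ≤ j * ε) : HasRotationNumber θ ρ := by
  constructor
  · rw [Metric.tendsto_atTop]
    intro ε hε
    obtain ⟨J, hJ⟩ := h (ε / 2) (by positivity)
    refine ⟨J + 1, fun n hn => ?_⟩
    obtain ⟨j, rfl⟩ := Int.eq_ofNat_of_zero_le (show 0 ≤ n by omega)
    have hj : (0 : ℝ) < j := by exact_mod_cast (show 0 < j by omega)
    have := (hJ j (by omega)).1
    rw [Real.dist_eq, Int.cast_natCast, div_sub' hj.ne', abs_div, abs_of_pos hj, div_lt_iff₀ hj]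
    calc _ ≤ (j : ℝ) * (ε / 2) := this
      _ < ε * j := by nlinarith
  · rw [Metric.tendsto_nhds]
    intro ε hε
    obtain ⟨J, hJ⟩ := h (ε / 2) (by positivity)
    filter_upwards [eventually_le_atBot (-(J + 1 : ℤ))] with n hn
    obtain ⟨j, hj'⟩ := Int.eq_ofNat_of_zero_le (show 0 ≤ -n by omega)
    obtain rfl : n = -(j : ℤ) := by omega
    have hj : (0 : ℝ) < j := by exact_mod_cast (show 0 < j by omega)
    have := (hJ j (by omega)).2
    have e : θ (-(j : ℤ)) / ((-(j : ℤ) : ℤ) : ℝ) - ρ = -((θ (-(j : ℤ)) + j * ρ) / j) := by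
      push_cast
      field_simp
      ring
    rw [Real.dist_eq, e, abs_neg, abs_div, abs_of_pos hj, div_lt_iff₀ hj]
    calc _ ≤ (j : ℝ) * (ε / 2) := this
      _ < ε * j := by nlinarith

/-- Every positive number is the rotation number of a minimal configuration. -/
theorem exists_isMinimalConfiguration_hasRotationNumber {s : ℤ → ℝ} {U V : ℝ → ℝ} {R : ℝ}
    (hs : IsQuasicrystal s) (hU : StrictConvexOn ℝ univ U) (hUd : Differentiable ℝ U)
    (hU' : StrictMono (deriv U)) (hVd : Differentiable ℝ V) (hVR : HasRange (range s) V R) {ρ : ℝ}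
    (hρ : 0 < ρ) : ∃ θ, IsMinimalConfiguration U V θ ∧ HasRotationNumber θ ρ := by
  have hex : ∀ L : ℕ, ∃ θ, IsMinPath U V (2 * (L + 1)) (-((L + 1 : ℕ) * ρ)) ((L + 1 : ℕ) * ρ) θ :=
    fun L => exists_isMinPath hUd.continuous hVd.continuous
      (by have : 0 < ((L + 1 : ℕ) : ℝ) * ρ := by positivity
          linarith) (by omega)
  choose Θ hΘ using hex
  have hb : Tendsto (fun L : ℕ => ((L + 1 : ℕ) : ℝ) * ρ) atTop atTop :=
    ((tendsto_natCast_atTop_atTop.comp (tendsto_add_atTop_nat 1))).atTop_mul_const hρ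
  have ha : Tendsto (fun L : ℕ => -(((L + 1 : ℕ) : ℝ) * ρ)) atTop atBot :=
    tendsto_neg_atTop_atBot.comp hb
  let N : ℕ → ℝ → ℕ := fun L x => atomCount (Θ L) (2 * (L + 1)) x
  have hdens : ∀ η, 0 < η → ∃ M₀ : ℝ, 0 < M₀ ∧ ∀ M, M₀ ≤ M → ∀ᶠ L in atTop,
      |(N L M : ℝ) - N L 0 - M / ρ| ≤ η * M ∧ |(N L 0 : ℝ) - N L (-M) - M / ρ| ≤ η * M := by
    intro η hη
    obtain ⟨M₀, hM₀, H⟩ := exists_atomCount_density hs hU hUd hU' hVd hVR hρ hη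
    refine ⟨M₀, hM₀, fun M hM => ?_⟩
    obtain ⟨n₀, hn₀⟩ := H M hM
    filter_upwards [eventually_ge_atTop n₀, hb.eventually_gt_atTop (4 * M)] with L hL hLM
    have hlen : ((L + 1 : ℕ) : ℝ) * ρ - -(((L + 1 : ℕ) : ℝ) * ρ) =
        ((2 * (L + 1) : ℕ) : ℝ) * ρ := by push_cast; ring
    have h1 := hn₀ (2 * (L + 1)) (by omega) _ _ _ (hΘ L) hlen 0 (by linarith) (by linarith)
    have h2 := hn₀ (2 * (L + 1)) (by omega) _ _ _ (hΘ L) hlen (-M) (by linarith) (by linarith)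
    rw [zero_add] at h1
    rw [neg_add_cancel] at h2
    exact ⟨h1, h2⟩
  have hlt : ∀ {L k : ℕ} {x : ℝ}, k ≤ 2 * (L + 1) → (k < N L x ↔ Θ L k < x) :=
    fun hk => lt_atomCount_iff ((hΘ _).monotone hU) hk
  have hNle : ∀ L x, N L x ≤ 2 * (L + 1) + 1 := fun L x => atomCount_le _ _ _
  have hbd : ∀ i : ℤ, ∃ C : ℝ, ∀ᶠ L in atTop, 0 ≤ N L 0 + i ∧ N L 0 + i ≤ (2 * (L + 1) : ℕ) ∧
      Θ L (N L 0 + i).toNat ∈ Icc (-C) C := by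
    intro i
    obtain ⟨M₀, hM₀, H⟩ := hdens (1 / (2 * ρ)) (by positivity)
    obtain ⟨M, hM⟩ : ∃ M, M = max M₀ (2 * ρ * (i.natAbs + 1)) := ⟨_, rfl⟩
    have hMi : (i.natAbs : ℝ) + 1 ≤ M / ρ - 1 / (2 * ρ) * M := by
      have h1 : 2 * ρ * (i.natAbs + 1) ≤ M := hM ▸ le_max_right _ _
      have e : M / ρ - 1 / (2 * ρ) * M = M / (2 * ρ) := by field_simp; ring
      rw [e, le_div_iff₀ (by positivity)]
      linarith
    refine ⟨M, ?_⟩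
    filter_upwards [H M (hM ▸ le_max_left _ _)] with L hL
    have h1 : N L 0 + i.natAbs + 1 ≤ N L M := by
      have : (N L 0 : ℝ) + i.natAbs + 1 ≤ N L M := by linarith [(abs_le.1 hL.1).1]
      exact_mod_cast this
    have h2 : N L (-M) + i.natAbs + 1 ≤ N L 0 := by
      have : (N L (-M) : ℝ) + i.natAbs + 1 ≤ N L 0 := by linarith [(abs_le.1 hL.2).1]
      exact_mod_cast this
    have h3 := hNle L M
    have h4 : (N L 0 + i).toNat ≤ 2 * (L + 1) := by omega
    refine ⟨by omega, by omega, not_lt.1 ((hlt h4).not.1 (by omega)), ((hlt h4).1 (by omega)).le⟩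
  obtain ⟨θ, hθ, hlim⟩ := exists_isMinimalConfiguration_of_isMinPath hU hUd.continuous
    hVd.continuous hΘ ha hb hbd
  refine ⟨θ, hθ, hasRotationNumber_of_forall fun ε' hε' => ?_⟩
  obtain ⟨ε, hε⟩ : ∃ ε, ε = min ε' (ρ / 2) := ⟨_, rfl⟩
  have hε0 : 0 < ε := hε ▸ lt_min hε' (by positivity)
  have hερ : ε ≤ ρ / 2 := hε ▸ min_le_right _ _
  have hεε' : ε ≤ ε' := hε ▸ min_le_left _ _
  obtain ⟨M₀, hM₀, H⟩ := hdens (ε / (2 * ρ * (ρ + ε))) (by positivity)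
  obtain ⟨J, hJ⟩ := exists_nat_ge (max (M₀ / (ρ / 2)) (2 * ρ / ε))
  have hJ1 : M₀ ≤ J * (ρ / 2) := (div_le_iff₀ (by positivity)).1 ((le_max_left _ _).trans hJ)
  have hJ2 : 2 * ρ ≤ J * ε := (div_le_iff₀ hε0).1 ((le_max_right _ _).trans hJ)
  refine ⟨J, fun j hj => ?_⟩
  have hjJ : (J : ℝ) ≤ j := by exact_mod_cast hj
  have hm1 : M₀ ≤ j * (ρ - ε) := hJ1.trans (by gcongr; linarith)
  have hm2 : M₀ ≤ j * (ρ + ε) := hm1.trans (by gcongr; linarith)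
  have hj2 : 2 * ρ ≤ j * ε := hJ2.trans (by gcongr)
  -- In the length `j (ρ + ε)` there are more than `j` atoms, and in `j (ρ - ε)` less.
  have up : (j : ℝ) + 1 ≤ j * (ρ + ε) / ρ - ε / (2 * ρ * (ρ + ε)) * (j * (ρ + ε)) := by
    have e : j * (ρ + ε) / ρ - ε / (2 * ρ * (ρ + ε)) * (j * (ρ + ε)) = j + j * ε / (2 * ρ) := by
      field_simp; ring
    have : 1 ≤ j * ε / (2 * ρ) := (one_le_div (by positivity)).2 hj2
    linarith
  have lo : j * (ρ - ε) / ρ + ε / (2 * ρ * (ρ + ε)) * (j * (ρ - ε)) ≤ (j : ℝ) - 1 := by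
    have h1 : ε / (2 * ρ * (ρ + ε)) * (j * (ρ - ε)) ≤ ε / (2 * ρ * (ρ + ε)) * (j * (ρ + ε)) := by
      gcongr; linarith
    have e : j * (ρ - ε) / ρ + ε / (2 * ρ * (ρ + ε)) * (j * (ρ + ε)) = j - j * ε / (2 * ρ) := by
      field_simp; ring
    have : 1 ≤ j * ε / (2 * ρ) := (one_le_div (by positivity)).2 hj2
    linarith
  have hjε : (j : ℝ) * ε ≤ j * ε' := by gcongr
  have key : ∀ᶠ L in atTop, Θ L (N L 0 + (j : ℤ)).toNat ∈ Icc (j * (ρ - ε)) (j * (ρ + ε)) ∧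
      Θ L (N L 0 + -(j : ℤ)).toNat ∈ Icc (-(j * (ρ + ε))) (-(j * (ρ - ε))) := by
    filter_upwards [H _ hm1, H _ hm2] with L h1 h2
    have c1 : N L 0 + j + 1 ≤ N L (j * (ρ + ε)) := by
      have : (N L 0 : ℝ) + j + 1 ≤ N L (j * (ρ + ε)) := by linarith [(abs_le.1 h2.1).1]
      exact_mod_cast this
    have c2 : N L (-(j * (ρ + ε))) + j + 1 ≤ N L 0 := by
      have : (N L (-(j * (ρ + ε))) : ℝ) + j + 1 ≤ N L 0 := by linarith [(abs_le.1 h2.2).1]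
      exact_mod_cast this
    have c3 : N L (j * (ρ - ε)) + 1 ≤ N L 0 + j := by
      have : (N L (j * (ρ - ε)) : ℝ) + 1 ≤ N L 0 + j := by linarith [(abs_le.1 h1.1).2]
      exact_mod_cast this
    have c4 : N L 0 + 1 ≤ N L (-(j * (ρ - ε))) + j := by
      have : (N L 0 : ℝ) + 1 ≤ N L (-(j * (ρ - ε))) + j := by linarith [(abs_le.1 h1.2).2]
      exact_mod_cast this
    have h3 := hNle L (j * (ρ + ε))
    have h4 : (N L 0 + (j : ℤ)).toNat ≤ 2 * (L + 1) := by omega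
    have h5 : (N L 0 + -(j : ℤ)).toNat ≤ 2 * (L + 1) := by omega
    exact ⟨⟨not_lt.1 ((hlt h4).not.1 (by omega)), ((hlt h4).1 (by omega)).le⟩,
      ⟨not_lt.1 ((hlt h5).not.1 (by omega)), ((hlt h5).1 (by omega)).le⟩⟩
  have k1 := hlim j _ isClosed_Icc (key.mono fun L hL => hL.1)
  have k2 := hlim (-j) _ isClosed_Icc (key.mono fun L hL => hL.2)
  constructor
  · rw [abs_le]; constructor <;> linarith [k1.1, k1.2]
  · rw [abs_le]; constructor <;> linarith [k2.1, k2.2]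

/-! ### Topology of the hull -/

theorem mem_closeSet_iff {T T' : Set ℝ} {ε : ℝ} : ε ∈ closeSet T T' ↔
    0 < ε ∧ ε < 1 ∧ ∃ u : ℝ, |u| < ε ∧ ∀ z, |z| < 1 / ε → (z ∈ T ↔ z - u ∈ T') := by
  simp only [closeSet, Set.ext_iff, shiftSet, mem_ofPred_eq, mem_inter_iff, Metric.mem_ball,
    dist_zero_right, Real.norm_eq_abs, and_congr_left_iff, sub_eq_add_neg]

namespace Hull

variable {Q : Set ℝ}

theorem dist_eq_patchDist (T T' : Hull Q) : dist T T' = patchDist T.1 T'.1 := rfl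

theorem mem_shift {u z : ℝ} {T : Hull Q} : z ∈ (shift u T).1 ↔ z + u ∈ T.1 := Iff.rfl

theorem shift_shift (u v : ℝ) (T : Hull Q) : shift u (shift v T) = shift (u + v) T :=
  Subtype.ext (Set.ext fun z => by rw [mem_shift, mem_shift, mem_shift, add_assoc])

theorem shift_zero (T : Hull Q) : shift 0 T = T :=
  Subtype.ext (Set.ext fun z => by rw [mem_shift, add_zero])

theorem eq_shift_iff {u : ℝ} {T T' : Hull Q} : T = shift u T' ↔ shift (-u) T = T' := by
  constructor
  · rintro rfl
    rw [shift_shift, neg_add_cancel, shift_zero]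
  · rintro rfl
    rw [shift_shift, add_neg_cancel, shift_zero]

theorem exists_agree (T : Hull Q) (M : ℝ) : ∃ x, ∀ z, |z| < M → (z ∈ T.1 ↔ z + x ∈ Q) := by
  obtain ⟨x, hx⟩ := (hull_condition_iff Q T.1).1 T.2 (max M 1) (by positivity)
  refine ⟨x, fun z hz => ?_⟩
  have := Set.ext_iff.1 hx z
  simp only [mem_inter_iff, Metric.mem_ball, dist_zero_right, Real.norm_eq_abs, shiftSet,
    mem_ofPred_eq, hz.trans_le (le_max_left M 1), and_true] at this
  exact this

theorem dist_le_of_agree {T T' : Hull Q} {e : ℝ} (h0 : 0 < e) (h1 : e < 1)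
    (h : ∀ z, |z| < 1 / e → (z ∈ T.1 ↔ z ∈ T'.1)) : dist T T' ≤ e :=
  max_le (patchGap_le (mem_closeSet_iff.2 ⟨h0, h1, 0, by simpa using h0, by simpa using h⟩))
    (patchGap_le (mem_closeSet_iff.2 ⟨h0, h1, 0, by simpa using h0,
      fun z hz => by simpa using (h z hz).symm⟩))

theorem exists_agree_of_patchGap_lt {T T' : Set ℝ} {e : ℝ} (he : e ≤ 1) (h : patchGap T T' < e) :
    ∃ u : ℝ, |u| < e ∧ ∀ z, |z| < 1 / e → (z ∈ T ↔ z - u ∈ T') := by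
  obtain ⟨ε, hε, hlt⟩ := exists_of_patchGap_lt h he
  obtain ⟨h0, h1, u, hu, hz⟩ := mem_closeSet_iff.1 hε
  exact ⟨u, hu.trans hlt, fun z hze => hz z (hze.trans_le (one_div_le_one_div_of_le h0 hlt.le))⟩

theorem continuous_shift : Continuous fun p : ℝ × Hull Q => shift p.1 p.2 := by
  -- Both orders of the arguments of `patchGap` are handled at once.
  have key : ∀ (u₀ : ℝ) (e : ℝ), 0 < e → e < 1 → ∃ κ, 0 < κ ∧ ∀ (u v : ℝ) (T T' : Set ℝ),
      |u - v| < κ → |u - u₀| < 1 → patchGap T T' < κ →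
      patchGap (shiftSet T u) (shiftSet T' v) ≤ e := by
    intro u₀ e he he1
    obtain ⟨A, hA⟩ : ∃ A, A = 1 / e + |u₀| + 1 := ⟨_, rfl⟩
    have hApos : 0 < A := by rw [hA]; positivity
    have hA1 : 1 / A ≤ 1 := (div_le_one hApos).2
      (by rw [hA]; linarith [abs_nonneg u₀, one_div_pos.2 he])
    refine ⟨min (e / 2) (1 / A), by positivity, fun u v T T' huv hu hT => ?_⟩
    obtain ⟨w, hw, hz⟩ := exists_agree_of_patchGap_lt ((min_le_right _ _).trans hA1) hT
    refine patchGap_le (mem_closeSet_iff.2 ⟨he, he1, w + v - u, ?_, fun z hze => ?_⟩)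
    · have h1 := abs_lt.1 (hw.trans_le (min_le_left _ _))
      have h2 := abs_lt.1 (huv.trans_le (min_le_left _ _))
      rw [abs_lt]
      constructor <;> linarith
    · have h1 : |z + u| < 1 / min (e / 2) (1 / A) := by
        refine lt_of_lt_of_le ?_ (one_div_le_one_div_of_le (by positivity) (min_le_right _ _))
        rw [one_div_one_div, hA, abs_lt]
        have h2 := abs_lt.1 hze
        have h3 := abs_lt.1 hu
        have h4 := abs_le.1 (le_refl |u₀|)
        constructor <;> linarith
      have := hz (z + u) h1
      simp only [shiftSet, mem_ofPred_eq]
      rw [this, show z - (w + v - u) + v = z + u - w by ring]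
  refine continuous_iff_continuousAt.2 fun ⟨u₀, T₀⟩ => ?_
  rw [ContinuousAt, Metric.tendsto_nhds]
  intro ε hε
  obtain ⟨κ, hκ, hκe⟩ := key u₀ (min (ε / 2) (1 / 2)) (by positivity)
    ((min_le_right _ _).trans_lt (by norm_num))
  filter_upwards [Metric.ball_mem_nhds (u₀, T₀) (lt_min hκ one_pos)] with ⟨u, T⟩ hp
  rw [Metric.mem_ball, Prod.dist_eq, max_lt_iff] at hp
  simp only [Real.dist_eq, dist_eq_patchDist, patchDist, max_lt_iff, lt_min_iff] at hp
  obtain ⟨⟨a1, a2⟩, ⟨b1, b2⟩, -⟩ := hp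
  refine lt_of_le_of_lt (max_le (hκe u u₀ T.1 T₀.1 a1 a2 b1) (hκe u₀ u T₀.1 T.1 ?_ ?_ b2))
    ((min_le_left _ _).trans_lt (by linarith))
  · rwa [abs_sub_comm]
  · simp

/-- A flow box is the projection of a closed set along a compact interval of times. -/
theorem isClosed_flowBox {C : Set (Hull Q)} (hC : IsClosed C) {J : Set ℝ} (hJ : IsCompact J) :
    IsClosed (flowBox C J) := by
  have : CompactSpace J := isCompact_iff_compactSpace.1 hJ
  have hcl : IsClosed {p : J × Hull Q | shift (-(p.1 : ℝ)) p.2 ∈ C} :=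
    hC.preimage (continuous_shift.comp
      ((continuous_subtype_val.comp continuous_fst).neg.prodMk continuous_snd))
  convert isClosedMap_snd_of_compactSpace _ hcl using 1
  ext T
  constructor
  · rintro ⟨T₀, hT₀, u, hu, rfl⟩
    have h : shift (-u) (shift u T₀) ∈ C := by
      rwa [shift_shift, neg_add_cancel, shift_zero]
    exact ⟨(⟨u, hu⟩, shift u T₀), h, rfl⟩
  · rintro ⟨⟨u, T'⟩, h, rfl⟩
    exact ⟨_, h, u, u.2, eq_shift_iff.2 rfl⟩

/-- A relatively open subset of the transversal contains, with `T`, all the elements of the hull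
which agree with `T` in a large ball. -/
theorem exists_agree_imp_mem {C : Set (Hull Q)} (hC : IsOpen ((↑) ⁻¹' C : Set (transversal Q)))
    (hsub : C ⊆ transversal Q) {T : Hull Q} (hT : T ∈ C) :
    ∃ M : ℝ, 0 < M ∧ ∀ T' : Hull Q, (∀ z, |z| < M → (z ∈ T'.1 ↔ z ∈ T.1)) → T' ∈ C := by
  obtain ⟨ε, hε, hball⟩ := Metric.isOpen_iff.1 hC ⟨T, hsub hT⟩ hT
  refine ⟨1 / min (ε / 2) (1 / 2), by positivity, fun T' h => ?_⟩
  have h0 : T' ∈ transversal Q := (h 0 (by rw [abs_zero]; positivity)).2 (hsub hT)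
  refine hball (show (⟨T', h0⟩ : transversal Q) ∈ _ from ?_)
  refine lt_of_le_of_lt (dist_le_of_agree (by positivity)
    ((min_le_right _ _).trans_lt (by norm_num)) h) ((min_le_left _ _).trans_lt (by linarith))

end Hull

/-! ### The hull of a quasicrystal -/

section QuasicrystalHull

open Hull

variable {s : ℤ → ℝ}

theorem abs_sub_ge_of_gap_ge {δ : ℝ} (hδ : 0 < δ) (h : ∀ n : ℤ, δ ≤ s (n + 1) - s n) {n m : ℤ}
    (hnm : n ≠ m) : δ ≤ |s n - s m| := by
  have key : ∀ n m : ℤ, n < m → δ ≤ s m - s n := by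
    intro n m hlt
    obtain ⟨k, hk⟩ := Int.eq_ofNat_of_zero_le (show 0 ≤ m - (n + 1) by omega)
    obtain rfl : m = n + (k + 1 : ℕ) := by push_cast; omega
    have := mul_le_sub_of_gap_ge h n (k + 1)
    push_cast at this ⊢
    have : 0 ≤ (k : ℝ) * δ := by positivity
    linarith
  rcases lt_or_gt_of_ne hnm with hlt | hlt
  · rw [abs_sub_comm]; exact (key n m hlt).trans (le_abs_self _)
  · exact (key m n hlt).trans (le_abs_self _)

theorem Hull.eq_of_abs_sub_lt {δ : ℝ} (hδ : 0 < δ) (h : ∀ n : ℤ, δ ≤ s (n + 1) - s n)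
    (T : Hull (range s)) {y z : ℝ} (hy : y ∈ T.1) (hz : z ∈ T.1) (hyz : |y - z| < δ) : y = z := by
  obtain ⟨x, hx⟩ := T.exists_agree (|y| + |z| + 1)
  obtain ⟨n, hn⟩ := (hx y (by linarith [abs_nonneg z])).1 hy
  obtain ⟨m, hm⟩ := (hx z (by linarith [abs_nonneg y])).1 hz
  by_contra hne
  have hnm : n ≠ m := by rintro rfl; exact hne (by linarith)
  have := abs_sub_ge_of_gap_ge hδ h hnm
  rw [hn, hm, add_sub_add_right_eq_sub] at this
  linarith

theorem isClosed_transversal (hs : IsQuasicrystal s) : IsClosed (transversal (range s)) := by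
  obtain ⟨δ, hδ, hgap⟩ := hs.exists_gap_ge
  refine isClosed_of_closure_subset fun T hT => ?_
  have hclose : ∀ e, 0 < e → e ≤ 1 → ∃ u ∈ T.1, |u| < e := by
    intro e he he1
    obtain ⟨T', hT', hd⟩ := Metric.mem_closure_iff.1 hT e he
    obtain ⟨u, hu, hz⟩ := Hull.exists_agree_of_patchGap_lt he1 ((le_max_left _ _).trans_lt hd)
    refine ⟨u, (hz u (hu.trans_le (he1.trans ((one_le_div he).2 he1)))).2 ?_, hu⟩
    rw [sub_self]; exact hT'
  obtain ⟨u, huT, hu⟩ := hclose (min (δ / 2) 1) (by positivity) (min_le_right _ _)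
  rcases eq_or_ne u 0 with rfl | hne
  · exact huT
  obtain ⟨v, hvT, hv⟩ := hclose (min |u| 1) (by positivity) (min_le_right _ _)
  have hvu : |v| < |u| := hv.trans_le (min_le_left _ _)
  have huδ : |u| < δ / 2 := hu.trans_le (min_le_left _ _)
  have : v = u := T.eq_of_abs_sub_lt hδ hgap hvT huT
    ((abs_sub v u).trans_lt (by linarith))
  rw [this] at hvu
  exact absurd hvu (lt_irrefl _)

theorem isClosed_of_isClosed_preimage (hs : IsQuasicrystal s) {C : Set (Hull (range s))}
    (hsub : C ⊆ transversal (range s))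
    (hC : IsClosed ((↑) ⁻¹' C : Set (transversal (range s)))) : IsClosed C := by
  have := hC.trans (isClosed_transversal hs)
  rwa [Subtype.image_preimage_coe, inter_eq_right.2 hsub] at this

theorem Hull.IsClopenPiece.step_bounds {δ G : ℝ} (hδ : 0 < δ)
    (h : ∀ n : ℤ, δ ≤ s (n + 1) - s n) (hG : ∀ n : ℤ, s (n + 1) - s n ≤ G)
    {C : Set (Hull (range s))} {L : ℝ} (hC : IsClopenPiece C L) (hne : C.Nonempty) :
    δ ≤ L ∧ L ≤ G := by
  obtain ⟨T, hT⟩ := hne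
  have h0 : (0 : ℝ) ∈ T.1 := hC.subset hT
  have hset : {t : ℝ | 0 < t ∧ shift t T ∈ transversal (range s)} = {t | 0 < t ∧ t ∈ T.1} := by
    ext t
    simp only [transversal, mem_ofPred_eq, mem_shift, zero_add]
  rw [← hC.returnTime_eq T hT, returnTime, hset]
  have hGpos : 0 < G := hδ.trans_le ((h 0).trans (hG 0))
  obtain ⟨x, hx⟩ := T.exists_agree (G + 1)
  obtain ⟨n, hn⟩ := (hx 0 (by rw [abs_zero]; linarith)).1 h0
  rw [zero_add] at hn
  have ht : s (n + 1) - s n ∈ {t | 0 < t ∧ t ∈ T.1} := by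
    have hpos : 0 < s (n + 1) - s n := hδ.trans_le (h n)
    refine ⟨hpos, (hx _ ?_).2 ⟨n + 1, by rw [← hn]; ring⟩⟩
    rw [abs_of_pos hpos]
    linarith [hG n]
  refine ⟨le_csInf ⟨_, ht⟩ fun t ht => ?_, (csInf_le ⟨0, fun t ht => ht.1.le⟩ ht).trans (hG n)⟩
  by_contra! hlt
  have := T.eq_of_abs_sub_lt hδ h ht.2 h0 (by rwa [sub_zero, abs_of_pos ht.1])
  exact ht.1.ne' this

/-- Around the centres of equivalent segments, the atoms are the same. -/
theorem SegEquiv.agree {δ M : ℝ} (hmono : StrictMono s) (h : ∀ n : ℤ, δ ≤ s (n + 1) - s n) {w : ℕ}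
    (hw : M ≤ w * δ) {n m : ℤ} (he : SegEquiv s (w + w) n m) {z : ℝ} (hz : |z| < M) :
    z + s (n + w) ∈ range s ↔ z + s (m + w) ∈ range s := by
  have key : ∀ n m : ℤ, SegEquiv s (w + w) n m → z + s (n + w) ∈ range s →
      z + s (m + w) ∈ range s := by
    rintro n m he ⟨k, hk⟩
    have hz' := abs_lt.1 hz
    have h1 := mul_le_sub_of_gap_ge h n w
    have h2 := mul_le_sub_of_gap_ge h (n + w) w
    have l1 : n < k := hmono.lt_iff_lt.1 (by linarith)
    have l2 : k < n + w + w := hmono.lt_iff_lt.1 (by linarith)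
    obtain ⟨i, hi⟩ := Int.eq_ofNat_of_zero_le (show 0 ≤ k - n by omega)
    obtain rfl : k = n + i := by omega
    refine ⟨m + i, ?_⟩
    rw [he.eq_add (by omega), he.eq_add (show w ≤ w + w by omega), hk]
    ring
  exact ⟨key n m he, key m n he.symm⟩

/-- Minimality of the translation flow on the hull: every orbit meets a non-empty clopen piece. -/
theorem exists_shift_mem (hs : IsQuasicrystal s) {C : Set (Hull (range s))} {L : ℝ}
    (hC : IsClopenPiece C L) (hne : C.Nonempty) (T : Hull (range s)) : ∃ t, shift t T ∈ C := by
  obtain ⟨δ, hδ, hgap⟩ := hs.exists_gap_ge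
  obtain ⟨T₀, hT₀⟩ := hne
  obtain ⟨M, hM, hmem⟩ := exists_agree_imp_mem hC.isClopen.2 hC.subset hT₀
  obtain ⟨x, hx⟩ := T₀.exists_agree M
  obtain ⟨c, hc⟩ := (hx 0 (by rwa [abs_zero])).1 (hC.subset hT₀)
  rw [zero_add] at hc
  obtain ⟨w, hw⟩ := exists_nat_ge (M / δ)
  rw [div_le_iff₀ hδ] at hw
  obtain ⟨R, hR, hrep⟩ := hs.repetitive (w + w) (c - w)
  obtain ⟨y, hy⟩ := T.exists_agree (R + M)
  obtain ⟨m, hm, hball⟩ := hrep y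
  have hb := hball w (by omega)
  rw [Metric.mem_ball, Real.dist_eq] at hb
  refine ⟨s (m + w) - y, hmem _ fun z hz => ?_⟩
  have h1 := hm.agree hs.strictMono hgap hw hz
  rw [sub_add_cancel, hc] at h1
  rw [hx z hz, h1, mem_shift, hy, show z + (s (m + w) - y) + y = z + s (m + w) by ring]
  exact (abs_add_le _ _).trans_lt (by linarith)

end QuasicrystalHull

section Returns

open Hull

variable {s : ℤ → ℝ}

/-! ### Return times to small pieces of the transversal -/

/-- A translation which preserves the set of atoms shifts their indices by a constant. -/
theorem isCrystal_of_translate (hmono : StrictMono s) {h : ℝ} (hh : 0 < h)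
    (hadd : ∀ n, s n + h ∈ range s) (hsub : ∀ n, s n - h ∈ range s) : IsCrystal s := by
  choose f hf using hadd
  choose g hg using hsub
  have hfs : ∀ n, f (n + 1) = f n + 1 := by
    intro n
    have h1 : f n < f (n + 1) :=
      hmono.lt_iff_lt.1 (by rw [hf, hf]; linarith [hmono (show n < n + 1 by omega)])
    have h2 : n < g (f n + 1) :=
      hmono.lt_iff_lt.1 (by rw [hg]; linarith [hmono (show f n < f n + 1 by omega), hf n])
    have h3 : f (n + 1) ≤ f n + 1 := by
      refine hmono.le_iff_le.1 ?_
      have := hmono.monotone (show n + 1 ≤ g (f n + 1) by omega)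
      rw [hg] at this
      rw [hf]
      linarith
    omega
  have hfn : ∀ n, f n = f 0 + n := by
    intro n
    induction n with
    | zero => simp
    | succ n ih => rw [hfs, ih]; ring
    | pred n ih =>
      have := hfs (-(n : ℤ) - 1)
      rw [sub_add_cancel, ih] at this
      omega
  have h0 : 0 < f 0 := hmono.lt_iff_lt.1 (by rw [hf]; linarith)
  refine ⟨(f 0).toNat, h, by omega, hh, fun n => ?_⟩
  rw [← hf n, hfn n, Int.toNat_of_nonneg h0.le, add_comm]

/-- In a quasicrystal which is not a crystal, large balls have no period `h`. -/
theorem eventually_localPatch_ne (hs : IsQuasicrystal s) (hcr : ¬ IsCrystal s) {h : ℝ}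
    (hh : 0 < h) :
    ∀ᶠ r in atTop, ∀ x, localPatch (range s) r x ≠ localPatch (range s) r (x + h) := by
  by_contra hcon
  rw [not_eventually] at hcon
  obtain ⟨δ, hδ, hgap⟩ := hs.exists_gap_ge
  obtain ⟨w, hw⟩ := exists_nat_gt (h / δ)
  rw [div_lt_iff₀ hδ] at hw
  have hshift : ∀ u : ℝ, |u| ≤ h → (∀ n, ∃ m, SegEquiv s (w + w) (n - w) (m - w) ∧
      s m + u ∈ range s) → ∀ n, s n + u ∈ range s := by
    intro u hu hex n
    obtain ⟨m, hm, hmu⟩ := hex n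
    have := hm.agree hs.strictMono hgap (M := w * δ) le_rfl (z := u) (hu.trans_lt hw)
    rw [sub_add_cancel, sub_add_cancel, add_comm, add_comm u] at this
    exact this.2 hmu
  have hocc : ∀ n, ∃ m, SegEquiv s (w + w) (n - w) (m - w) ∧ s m + h ∈ range s ∧
      s m - h ∈ range s := by
    intro n
    obtain ⟨R, hR, hrep⟩ := hs.repetitive (w + w) (n - w)
    obtain ⟨r, hr, hx⟩ := frequently_atTop.1 hcon (R + h)
    push Not at hx
    obtain ⟨x, hx⟩ := hx
    obtain ⟨m, hm, hball⟩ := hrep x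
    have hb := hball w (by omega)
    rw [Metric.mem_ball, Real.dist_eq, abs_lt] at hb
    have hiff : ∀ z, |z| < r → (z + x ∈ range s ↔ z + (x + h) ∈ range s) := by
      intro z hz
      have := Set.ext_iff.1 hx z
      simpa only [localPatch, shiftSet, mem_ofPred_eq, mem_inter_iff, Metric.mem_ball, Real.dist_eq,
        add_sub_cancel_right, hz, and_true] using this
    refine ⟨m + w, by rwa [add_sub_cancel_right], ?_, ?_⟩
    · have := (hiff (s (m + w) - x) (by rw [abs_lt]; constructor <;> linarith)).1
        ⟨m + w, by ring⟩
      rwa [show s (m + w) - x + (x + h) = s (m + w) + h by ring] at this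
    · have := (hiff (s (m + w) - (x + h)) (by rw [abs_lt]; constructor <;> linarith)).2
        ⟨m + w, by ring⟩
      rwa [show s (m + w) - (x + h) + x = s (m + w) - h by ring] at this
  refine hcr (isCrystal_of_translate hs.strictMono hh
    (hshift h (abs_of_pos hh).le fun n => ?_) ?_)
  · obtain ⟨m, h1, h2, -⟩ := hocc n
    exact ⟨m, h1, h2⟩
  · simp only [sub_eq_add_neg]
    refine hshift (-h) (by rw [abs_neg, abs_of_pos hh]) fun n => ?_
    obtain ⟨m, h1, -, h2⟩ := hocc n
    exact ⟨m, h1, by rwa [← sub_eq_add_neg]⟩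

theorem finite_differences (hs : IsQuasicrystal s) (H : ℝ) :
    {h : ℝ | 0 < h ∧ h ≤ H ∧ ∃ x ∈ range s, x + h ∈ range s}.Finite := by
  obtain ⟨F, hF⟩ := hs.finiteLocalComplexity (max H 0 + 1) (by positivity)
  refine (F.finite_toSet.image fun q => s (q.2 + q.1) - s q.2).subset ?_
  rintro h ⟨h0, hH, _, ⟨n, rfl⟩, m, hm⟩
  have hnm : n < m := hs.strictMono.lt_iff_lt.1 (by linarith)
  obtain ⟨p, hp⟩ := Int.eq_ofNat_of_zero_le (show 0 ≤ m - n by omega)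
  obtain rfl : m = n + p := by omega
  obtain ⟨k, hk, he⟩ := hF p n (by linarith [le_max_left H 0])
  refine ⟨_, hk, ?_⟩
  have := he.eq_add le_rfl
  simp only
  linarith

/-- Returns to the base of a towers system in bounded time do not occur when the size is large. -/
theorem eventually_noReturn (hs : IsQuasicrystal s) (hcr : ¬ IsCrystal s) (H : ℝ) :
    ∀ᶠ r in atTop, ∀ ε, IsAdmissible (range s) r ε → ∀ (C : Set (Hull (range s))) (L : ℝ),
      IsClopenPiece C L → Metric.diam C < ε →
      ∀ T ∈ C, ∀ h, 0 < h → h ≤ H → shift h T ∉ C := by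
  obtain ⟨δ, hδ, hgap⟩ := hs.exists_gap_ge
  obtain ⟨G, hG, hgap'⟩ := hs.exists_gap_le
  filter_upwards [(eventually_all_finite (finite_differences hs H)).2
    fun h hh => eventually_localPatch_ne hs hcr hh.1] with r hr ε hε C L hC hdiam T hT h h0 hH hTh
  have hL := (hC.step_bounds hδ hgap hgap' ⟨T, hT⟩).1
  have hvert : IsVertical C := ⟨C, L, hC, 0, ⟨le_rfl, hδ.trans_le hL⟩, by simp [shift_zero]⟩
  obtain ⟨M₁, hM₁, hmem₁⟩ := exists_agree_imp_mem hC.isClopen.2 hC.subset hT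
  obtain ⟨M₂, hM₂, hmem₂⟩ := exists_agree_imp_mem hC.isClopen.2 hC.subset hTh
  obtain ⟨x, hx⟩ := T.exists_agree (M₁ + M₂ + h)
  have hx1 : ofReal (range s) x ∈ C := hmem₁ _ fun z hz => (hx z (by linarith)).symm
  have hx2 : ofReal (range s) (x + h) ∈ C := by
    refine hmem₂ _ fun z hz => ?_
    have h1 : |z + h| ≤ |z| + h := (abs_add_le z h).trans_eq (by rw [abs_of_pos h0])
    rw [mem_shift, hx (z + h) (by linarith)]
    change z + (x + h) ∈ range s ↔ _
    rw [show z + h + x = z + (x + h) by ring]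
  have hxQ : ∀ y, ofReal (range s) y ∈ C → y ∈ range s := by
    intro y hy
    have : 0 + y ∈ range s := hC.subset hy
    rwa [zero_add] at this
  exact hr h ⟨h0, hH, x, hxQ x hx1, hxQ _ hx2⟩ x (hε.2 C hvert hdiam _ _ hx1 hx2)

/-! ### Transverse measure of the bases -/

/-- Two orbit segments of length `≤ H` starting in a set without returns before the time `H` meet
only if they coincide. -/
theorem eq_of_shift_eq_shift {C : Set (Hull (range s))} {H : ℝ}
    (hret : ∀ T ∈ C, ∀ h, 0 < h → h ≤ H → shift h T ∉ C) {T T' : Hull (range s)} (hT : T ∈ C)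
    (hT' : T' ∈ C) {a b : ℝ} (h : shift a T = shift b T') (hab : |a - b| ≤ H) : a = b ∧ T = T' := by
  have key : ∀ {T T' : Hull (range s)} {a b : ℝ}, T ∈ C → T' ∈ C → shift a T = shift b T' →
      |a - b| ≤ H → ¬ a < b := by
    intro T T' a b hT hT' h hab hlt
    refine hret T' hT' (b - a) (sub_pos.2 hlt)
      (by rwa [abs_sub_comm, abs_of_pos (sub_pos.2 hlt)] at hab) ?_
    rw [sub_eq_neg_add, ← shift_shift, ← h, shift_shift, neg_add_cancel, shift_zero]
    exact hT
  have hle : a = b := le_antisymm (not_lt.1 (key hT' hT h.symm (by rwa [abs_sub_comm])))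
    (not_lt.1 (key hT hT' h hab))
  subst hle
  refine ⟨rfl, ?_⟩
  rw [eq_shift_iff, shift_shift, neg_add_cancel, shift_zero] at h
  exact h

theorem TowerSystem.nu_nonneg (hs : IsQuasicrystal s)
    (μ : Measure (Hull (range s))) {ε : ℝ} (K : TowerSystem (range s) ε)
    (j : Fin K.r) : 0 ≤ K.nu μ j := by
  obtain ⟨δ, hδ, hgap⟩ := hs.exists_gap_ge
  obtain ⟨G, hG, hgap'⟩ := hs.exists_gap_le
  exact div_nonneg measureReal_nonneg
    (hδ.le.trans (K.isClopenPiece.step_bounds hδ hgap hgap' K.nonempty).1)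

variable {μ : Measure (Hull (range s))} [IsProbabilityMeasure μ]

/-- Countably many translates of the flow box cover the hull. -/
theorem measureReal_flowBox_pos (hs : IsQuasicrystal s)
    (hμ : ∀ u : ℝ, MeasurePreserving (shift (Q := range s) u) μ μ) {C : Set (Hull (range s))}
    {L : ℝ} (hC : IsClopenPiece C L) (hne : C.Nonempty) : 0 < μ.real (flowBox C (Icc 0 L)) := by
  obtain ⟨δ, hδ, hgap⟩ := hs.exists_gap_ge
  obtain ⟨G, hG, hgap'⟩ := hs.exists_gap_le
  have hL : 0 < L := hδ.trans_le (hC.step_bounds hδ hgap hgap' hne).1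
  have hmeas : MeasurableSet (flowBox C (Icc 0 L)) := (isClosed_flowBox
    (isClosed_of_isClosed_preimage hs hC.subset hC.isClopen.1) isCompact_Icc).measurableSet
  have hcover : (⋃ k : ℤ, shift (-(k * L)) ⁻¹' flowBox C (Icc 0 L)) = univ := by
    refine eq_univ_of_forall fun T => mem_iUnion.2 ?_
    obtain ⟨t, ht⟩ := exists_shift_mem hs hC hne T
    refine ⟨⌊-t / L⌋, shift t T, ht, -t - ⌊-t / L⌋ * L, ⟨?_, ?_⟩, ?_⟩
    · have := Int.floor_le (-t / L)
      rw [le_div_iff₀ hL] at this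
      linarith
    · have := (Int.lt_floor_add_one (-t / L)).le
      rw [div_le_iff₀ hL] at this
      linarith
    · rw [shift_shift]
      congr 1
      ring
  refine ENNReal.toReal_pos (fun h0 => ?_) (measure_ne_top _ _)
  have : μ univ = 0 := by
    rw [← hcover, measure_iUnion_null_iff]
    intro k
    rw [(hμ _).measure_preimage hmeas.nullMeasurableSet, h0]
  simp at this

/-- If there is no return to `C` before the time `2 L m`, then `m` translated copies of the flow box
over `C` are disjoint. -/
theorem mul_measureReal_flowBox_le (hs : IsQuasicrystal s)
    (hμ : ∀ u : ℝ, MeasurePreserving (shift (Q := range s) u) μ μ) {C : Set (Hull (range s))}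
    {L : ℝ} (hC : IsClopenPiece C L) (hL : 0 < L) {m : ℕ}
    (hret : ∀ T ∈ C, ∀ h, 0 < h → h ≤ 2 * L * m → shift h T ∉ C) :
    m * μ.real (flowBox C (Icc 0 L)) ≤ 1 := by
  have hmeas : MeasurableSet (flowBox C (Icc 0 L)) := (isClosed_flowBox
    (isClosed_of_isClosed_preimage hs hC.subset hC.isClopen.1) isCompact_Icc).measurableSet
  have hdisj : (↑(Finset.range m) : Set ℕ).PairwiseDisjoint
      fun k : ℕ => shift (-(2 * L * k)) ⁻¹' flowBox C (Icc 0 L) := by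
    intro k hk k' hk' hne
    rw [Function.onFun, Set.disjoint_left]
    rintro T ⟨T₀, hT₀, u, hu, h1⟩ ⟨T₁, hT₁, v, hv, h2⟩
    rw [← eq_shift_iff, shift_shift] at h1 h2
    rw [Finset.coe_range, mem_Iio] at hk hk'
    have b1 : (k : ℝ) + 1 ≤ m := by exact_mod_cast hk
    have b2 : (k' : ℝ) + 1 ≤ m := by exact_mod_cast hk'
    have b3 := mul_le_mul_of_nonneg_left b1 (show 0 ≤ 2 * L by linarith)
    have b4 := mul_le_mul_of_nonneg_left b2 (show 0 ≤ 2 * L by linarith)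
    have b5 : 0 ≤ 2 * L * (k : ℝ) := by positivity
    have b6 : 0 ≤ 2 * L * (k' : ℝ) := by positivity
    have heq := (eq_of_shift_eq_shift hret hT₀ hT₁ (h1.symm.trans h2) (by
      rw [abs_le]; constructor <;> linarith [hu.1, hu.2, hv.1, hv.2])).1
    rcases Nat.lt_or_gt_of_ne hne with hlt | hlt
    · have : (k : ℝ) + 1 ≤ k' := by exact_mod_cast hlt
      have := mul_le_mul_of_nonneg_left this (show 0 ≤ 2 * L by linarith)
      linarith [hu.1, hu.2, hv.1, hv.2]
    · have : (k' : ℝ) + 1 ≤ k := by exact_mod_cast hlt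
      have := mul_le_mul_of_nonneg_left this (show 0 ≤ 2 * L by linarith)
      linarith [hu.1, hu.2, hv.1, hv.2]
  have hsum := measureReal_biUnion_finset (μ := μ) hdisj
    (fun k _ => (hμ _).measurable hmeas)
  have hk : ∀ k ∈ Finset.range m, μ.real (shift (-(2 * L * (k : ℝ))) ⁻¹' flowBox C (Icc 0 L)) =
      μ.real (flowBox C (Icc 0 L)) := fun k _ => (hμ _).measureReal_preimage hmeas.nullMeasurableSet
  rw [Finset.sum_congr rfl hk, Finset.sum_const, Finset.card_range, nsmul_eq_mul] at hsum
  rw [← hsum]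
  exact measureReal_le_one

theorem flowBox_base {ε : ℝ} (K : TowerSystem (range s) ε) (J : Set ℝ) :
    flowBox K.base J = ⋃ j, flowBox (K.E j) J := by
  ext T
  simp only [flowBox, ← K.iUnion_E, mem_ofPred_eq, mem_iUnion]
  constructor
  · rintro ⟨T₀, ⟨j, hj⟩, u, hu, rfl⟩
    exact ⟨j, T₀, hj, u, hu, rfl⟩
  · rintro ⟨j, T₀, hj, u, hu, rfl⟩
    exact ⟨T₀, ⟨j, hj⟩, u, hu, rfl⟩

theorem TowerSystem.sum_nu_pos (hs : IsQuasicrystal s)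
    (hμ : ∀ u : ℝ, MeasurePreserving (shift (Q := range s) u) μ μ) {ε : ℝ}
    (K : TowerSystem (range s) ε) : 0 < ∑ j, K.nu μ j := by
  obtain ⟨δ, hδ, hgap⟩ := hs.exists_gap_ge
  obtain ⟨G, hG, hgap'⟩ := hs.exists_gap_le
  have hL := hδ.trans_le (K.isClopenPiece.step_bounds hδ hgap hgap' K.nonempty).1
  simp only [TowerSystem.nu, transverseMeasure]
  rw [← Finset.sum_div]
  refine div_pos ((measureReal_flowBox_pos hs hμ K.isClopenPiece K.nonempty).trans_le ?_) hL
  rw [flowBox_base]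
  exact measureReal_iUnion_fintype_le _

/-- The total transverse measure of a towers system is small when its size is large. -/
theorem eventually_sum_nu_lt (hs : IsQuasicrystal s) (hcr : ¬ IsCrystal s)
    (hμ : ∀ u : ℝ, MeasurePreserving (shift (Q := range s) u) μ μ) {c : ℝ} (hc : 0 < c) :
    ∀ᶠ r in atTop, ∀ ε, IsAdmissible (range s) r ε → ∀ K : TowerSystem (range s) ε,
      ∑ j, K.nu μ j < c := by
  obtain ⟨δ, hδ, hgap⟩ := hs.exists_gap_ge
  obtain ⟨G, hG, hgap'⟩ := hs.exists_gap_le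
  obtain ⟨m, hm⟩ := exists_nat_gt (1 / (c * δ))
  have hmpos : (0 : ℝ) < m := lt_of_le_of_lt (by positivity) hm
  have hm1 : (1 : ℝ) ≤ m := by exact_mod_cast hmpos
  filter_upwards [eventually_noReturn hs hcr (2 * G * m)] with r hr ε hε K
  have hret := hr ε hε K.base K.step K.isClopenPiece K.diam_lt
  obtain ⟨hL1, hL2⟩ := K.isClopenPiece.step_bounds hδ hgap hgap' K.nonempty
  have hL : 0 < K.step := hδ.trans_le hL1
  have hle := mul_measureReal_flowBox_le hs hμ K.isClopenPiece hL (m := m)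
    fun T hT h h0 hh => hret T hT h h0 (hh.trans (by gcongr))
  have hE : ∀ j, K.E j ⊆ K.base := fun j => K.iUnion_E ▸ subset_iUnion K.E j
  have hdisj : Pairwise (Function.onFun Disjoint fun j => flowBox (K.E j) (Icc 0 K.step)) := by
    intro i j hij
    rw [Function.onFun, Set.disjoint_left]
    rintro _ ⟨T₀, hT₀, u, hu, rfl⟩ ⟨T₁, hT₁, v, hv, h⟩
    have hGm : G ≤ 2 * G * m := by nlinarith
    have := (eq_of_shift_eq_shift hret (hE i hT₀) (hE j hT₁) h (by
      rw [abs_le]; constructor <;> linarith [hu.1, hu.2, hv.1, hv.2])).2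
    subst this
    exact Set.disjoint_left.1 (K.disjoint_E hij) hT₀ hT₁
  have hmeas : ∀ j, MeasurableSet (flowBox (K.E j) (Icc 0 K.step)) := fun j =>
    (isClosed_flowBox (isClosed_of_isClosed_preimage hs ((hE j).trans K.isClopenPiece.subset)
      (K.isClopen_E j).1) isCompact_Icc).measurableSet
  have hsum : μ.real (flowBox K.base (Icc 0 K.step)) =
      ∑ j, μ.real (flowBox (K.E j) (Icc 0 K.step)) := by
    rw [flowBox_base, measureReal_iUnion_fintype hdisj hmeas]
  simp only [TowerSystem.nu, transverseMeasure]
  rw [← Finset.sum_div, ← hsum, div_lt_iff₀ hL]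
  rw [div_lt_iff₀ (by positivity)] at hm
  have h1 : c * δ ≤ c * K.step := by gcongr
  have h2 : m * μ.real (flowBox K.base (Icc 0 K.step)) < m * (c * K.step) :=
    hle.trans_lt (hm.trans_le (by gcongr))
  exact lt_of_mul_lt_mul_left h2 hmpos.le

end Returns

end

theorem mainTheorem3 (s : ℤ → ℝ) (hs : IsQuasicrystal s) (hcr : ¬ IsCrystal s)
    (U V : ℝ → ℝ) (hU : ContDiff ℝ 2 U) (hV : ContDiff ℝ 2 V)
    (hconv : ∀ x : ℝ, 0 < deriv (deriv U) x)
    (htop : Tendsto (fun x : ℝ => U x / |x|) atTop atTop)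
    (hbot : Tendsto (fun x : ℝ => U x / |x|) atBot atTop)
    (R : ℝ) (hR : 0 < R) (hVR : HasRange (Set.range s) V R)
    (μ : Measure (Hull (Set.range s))) [IsProbabilityMeasure μ]
    (hμ : ∀ u : ℝ, MeasurePreserving (Hull.shift (Q := Set.range s) u) μ μ)
    (ε : ℝ → ℝ) (hε : ∀ r : ℝ, 0 < r → Hull.IsAdmissible (Set.range s) r (ε r))
    (S : ℕ → ℝ) (hS : StrictMono S) (hStop : Tendsto S atTop atTop) (hS0 : R < S 0)
    (K : TowerSequence (Set.range s) ε S) :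
    (∀ ρ₀ ∈ rotationSet K μ, ∃ θ : ℤ → ℝ,
      IsMinimalConfiguration U V θ ∧ HasRotationNumber θ ρ₀) ∧
    rotationSet K μ ⊆ Set.Ioi 0 ∧ Set.Ioi 0 ⊆ closure (rotationSet K μ) := by
  have hUd : Differentiable ℝ U := hU.differentiable (by norm_num)
  have hVd : Differentiable ℝ V := hV.differentiable (by norm_num)
  have hUstrict : StrictConvexOn ℝ univ U := strictConvexOn_of_deriv2_pos' convex_univ
    hUd.continuous.continuousOn fun x _ => hconv x
  have hU' : StrictMono (deriv U) := strictMono_of_deriv_pos hconv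
  have hpos : rotationSet K μ ⊆ Set.Ioi 0 := by
    rintro _ ⟨l, N, hN, rfl⟩
    refine one_div_pos.2 (((K.sys l).sum_nu_pos hs hμ).trans_le (Finset.sum_le_sum fun j _ => ?_))
    exact le_mul_of_one_le_left ((K.sys l).nu_nonneg hs μ j) (by exact_mod_cast hN j)
  refine ⟨fun ρ₀ hρ₀ => exists_isMinimalConfiguration_hasRotationNumber hs hUstrict hUd hU' hVd
    hVR (hpos hρ₀), hpos, fun x hx => ?_⟩
  rw [Set.mem_Ioi] at hx
  -- The multiples of the small numbers `σ l` come close to `1 / x`.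
  obtain ⟨σ, hσ⟩ : ∃ σ : ℕ → ℝ, σ = fun l => ∑ j, (K.sys l).nu μ j := ⟨_, rfl⟩
  have hσpos : ∀ l, 0 < σ l := fun l => by rw [hσ]; exact (K.sys l).sum_nu_pos hs hμ
  have hσ0 : Tendsto σ atTop (𝓝 0) := by
    rw [Metric.tendsto_nhds]
    intro c hc
    filter_upwards [hStop.eventually (eventually_sum_nu_lt hs hcr hμ hc)] with l hl
    rw [Real.dist_eq, sub_zero, abs_of_pos (hσpos l), hσ]
    exact hl _ (hε _ (hR.trans (hS0.trans_le (hS.monotone (Nat.zero_le l))))) _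
  have hlim : Tendsto (fun l => (⌈1 / (x * σ l)⌉₊ : ℝ) * σ l) atTop (𝓝 (1 / x)) := by
    refine tendsto_of_tendsto_of_tendsto_of_le_of_le tendsto_const_nhds
      (by simpa using tendsto_const_nhds.add hσ0) (fun l => ?_) (fun l => ?_)
    · have := mul_le_mul_of_nonneg_right (Nat.le_ceil (1 / (x * σ l))) (hσpos l).le
      refine le_trans (le_of_eq ?_) this
      have := (hσpos l).ne'
      field_simp
    · have := mul_le_mul_of_nonneg_right (Nat.ceil_lt_add_one (a := 1 / (x * σ l))
        (by have := hσpos l; positivity)).le (hσpos l).le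
      refine this.trans (le_of_eq ?_)
      have := (hσpos l).ne'
      field_simp
  have hlim' := hlim.inv₀ (by positivity)
  rw [one_div, inv_inv] at hlim'
  refine mem_closure_of_tendsto hlim' (Eventually.of_forall fun l => ?_)
  refine ⟨l, fun _ => ⌈1 / (x * σ l)⌉₊, fun _ => Nat.ceil_pos.2 ?_, ?_⟩
  · have := hσpos l
    positivity
  · simp only [hσ, ← Finset.mul_sum, one_div]
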